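/- Let $m,d\in\mathbb N$ be fixed. Let $I$ and $\tilde I$ be random vectors in $\mathbb R^m$, $X$ and $\tilde X$ random vectors in $\mathbb R^d$, and $Y,\epsilon$ real random variables with $Y=X^\top\beta^*+\epsilon$ for some $\beta^*\in\mathbb R^d$. Assume that $I,X,Y,\tilde I,\tilde X$ have mean zero and finite fourth moments, and that $$\operatorname{Cov}(\tilde I,\tilde X)=\operatorname{Cov}(I,X)=:C\in\mathbb R^{m\times d},\qquad \mathbb E[\epsilon\mid I]=0,\qquad \operatorname{rank}(C)=d .$$ Let $(I_i,Y_i)_{i\ge1}$ be i.i.d. copies of $(I,Y)$ and $(\tilde I_j,\tilde X_j)_{j\ge1}$ i.i.d. copies of $(\tilde I,\tilde X)$, the two sequences being independent of each other. Let the sample sizes $n,\tilde n\to\infty$ be such that, with $N=n+\tilde n$, $\tau_n=n/N\to\tau\in(0,1)$ and $\tilde\tau_n=\tilde n/N\to\tilde\tau\in(0,1)$. Let $W_N\in\mathbb R^{m\times m}$ be random matrices that are positive definite with probability tending to one, and let $W_N\overset{p}{\to}W_0$ with $W_0$ symmetric positive definite. Put $$\hat g_N(\beta)=\frac1n\sum_{i=1}^n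 I_iY_i-\hat C\beta,\qquad \hat C=\frac1{\tilde n}\sum_{j=1}^{\tilde n}\tilde I_j\tilde X_j^\top ,$$ and let the unpaired GMM estimator $\hat\beta_N$ be a (measurable) random vector that minimizes $\beta\mapsto\hat g_N(\beta)^\top W_N\,\hat g_N(\beta)$ over $\mathbb R^d$ whenever $W_N$ is positive definite. Define $$\Omega=\tau^{-1}\operatorname{Var}(IY)+\tilde\tau^{-1}\operatorname{Var}(\tilde I\tilde X^\top\beta^*),\qquad V(W)=(C^\top WC)^{-1}C^\top W\Omega WC\,(C^\top WC)^{-1}.$$ Then: 1. $\hat\beta_N\overset{p}{\to}\beta^*$. 2. $\sqrt N(\hat\beta_N-\beta^*)\overset{d}{\to}\mathcal N(0,V(W_0))$. 3. If $\Omega$ is positive definite, then $V(W)-V(\Omega^{-1})$ is positive semidefinite for every symmetric positive definite $W$; that is, the choice $W_0=\Omega^{-1}$ minimizes the asymptotic variance. 4. If $\Omega$ is positive definite and $W_0=\Omega^{-1}$, let $\hat\beta^{(0)}$ be any consistent estimator of $\beta^*$, let $\hat\Omega=\tau_n^{-1}\hat\Omega_m+\tilde\tau_n^{-1}\hat\Omega_c$,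 where $\hat\Omega_m$ and $\hat\Omega_c$ are the empirical covariance matrices (with normalizations $1/n$ and $1/\tilde n$) of $(I_iY_i)_{i\le n}$ and $(\tilde I_j\tilde X_j^\top\hat\beta^{(0)})_{j\le\tilde n}$, and let $\hat V$ be $V(\Omega^{-1})$ with $C,\Omega$ replaced by $\hat C,\hat\Omega$. Then $$\sqrt N\,\hat V^{-1/2}(\hat\beta_N-\beta^*)\overset{d}{\to}\mathcal N(0,\mathrm{Id}_d).$$ (Matrices that are not invertible, an event whose probability tends to zero, are given the inverse $0$.) The same four conclusions hold if, in $\hat g_N$, $\hat C$, $\hat\Omega$ and $\hat V$, each of the observations $I_i,Y_i,\tilde I_j,\tilde X_j$ is replaced by its difference from its sample mean. -/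

import Mathlib

open MeasureTheory ProbabilityTheory Filter Topology Matrix

noncomputable section

namespace UnpairedIV

variable {m d : ℕ}

/-- The cross-covariance matrix `Cov(A, B)` of two random vectors. -/
def crossCov {S : Type*} [MeasurableSpace S] (μ : Measure S)
    (A : S → Fin m → ℝ) (B : S → Fin d → ℝ) : Matrix (Fin m) (Fin d) ℝ :=
  Matrix.of fun a b => cov[fun s => A s a, fun s => B s b; μ]

/-- The covariance matrix `Var(A)` of a random vector. -/
def varMatrix {S : Type*} [MeasurableSpace S] (μ : Measure S)
    (A : S → Fin m → ℝ) : Matrix (Fin m) (Fin m) ℝ :=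
  crossCov μ A A

/-- The two-sample moment variance
`Ω = τ⁻¹ Var(I Y) + τ'⁻¹ Var(I' X'ᵀ β)`, where `(I', X')` is the second system. -/
def momentVar {S : Type*} [MeasurableSpace S] (μ : Measure S) (τ τ' : ℝ)
    (I : S → Fin m → ℝ) (Y : S → ℝ) (I' : S → Fin m → ℝ) (X' : S → Fin d → ℝ)
    (β : EuclideanSpace ℝ (Fin d)) : Matrix (Fin m) (Fin m) ℝ :=
  τ⁻¹ • varMatrix μ (fun s => Y s • I s) +
    τ'⁻¹ • varMatrix μ (fun s => (X' s ⬝ᵥ β.ofLp) • I' s)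

/-- The sandwich matrix `(CᵀWC)⁻¹ CᵀWΩWC (CᵀWC)⁻¹`. -/
def sandwich (C : Matrix (Fin m) (Fin d) ℝ) (Ω W : Matrix (Fin m) (Fin m) ℝ) :
    Matrix (Fin d) (Fin d) ℝ :=
  (Cᵀ * W * C)⁻¹ * (Cᵀ * W * Ω * W * C) * (Cᵀ * W * C)⁻¹

/-- The average `n⁻¹ ∑_{i < n} v i` of the first `n` terms. -/
def avg {E : Type*} [AddCommGroup E] [Module ℝ E] (n : ℕ) (v : ℕ → E) : E :=
  (n : ℝ)⁻¹ • ∑ i ∈ Finset.range n, v i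

/-- How the observations enter the sample moments: `population` means that the (mean zero)
variables are used as they are, `sampleMean` that the sample mean is subtracted first. -/
inductive Centering where
  | population
  | sampleMean

/-- The observations, as they enter the sample moments based on a sample of size `n`. -/
def Centering.obs {E : Type*} [AddCommGroup E] [Module ℝ E] (c : Centering) (n : ℕ)
    (v : ℕ → E) : ℕ → E :=
  match c with
  | .population => v
  | .sampleMean => fun i => v i - avg n v

/-- `n⁻¹ ∑ I_i Y_i`. -/
def momentIY (n : ℕ) (I : ℕ → Fin m → ℝ) (Y : ℕ → ℝ) : Fin m → ℝ :=
  avg n fun i => Y i • I i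

/-- `n⁻¹ ∑ I_j X_jᵀ`. -/
def momentIX (n : ℕ) (I : ℕ → Fin m → ℝ) (X : ℕ → Fin d → ℝ) : Matrix (Fin m) (Fin d) ℝ :=
  avg n fun j => vecMulVec (I j) (X j)

/-- The sample moment `g(β) = n⁻¹ ∑ I_i Y_i - (n'⁻¹ ∑ I'_j X'_jᵀ) β`. -/
def sampleMoment (n n' : ℕ) (I : ℕ → Fin m → ℝ) (Y : ℕ → ℝ)
    (I' : ℕ → Fin m → ℝ) (X' : ℕ → Fin d → ℝ) (β : EuclideanSpace ℝ (Fin d)) : Fin m → ℝ :=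
  momentIY n I Y - momentIX n' I' X' *ᵥ β.ofLp

/-- `β` minimizes the criterion `b ↦ g(b)ᵀ W g(b)` over `ℝᵈ`. -/
def IsGMM (W : Matrix (Fin m) (Fin m) ℝ) (n n' : ℕ) (I : ℕ → Fin m → ℝ) (Y : ℕ → ℝ)
    (I' : ℕ → Fin m → ℝ) (X' : ℕ → Fin d → ℝ) (β : EuclideanSpace ℝ (Fin d)) : Prop :=
  IsMinOn (fun b => sampleMoment n n' I Y I' X' b ⬝ᵥ W *ᵥ sampleMoment n n' I Y I' X' b)
    Set.univ β

/-- The empirical covariance matrix of `v 0, …, v (n - 1)`, with normalization `n⁻¹`. -/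
def empVar (n : ℕ) (v : ℕ → Fin m → ℝ) : Matrix (Fin m) (Fin m) ℝ :=
  avg n fun i => vecMulVec (v i - avg n v) (v i - avg n v)

/-- The estimator of `Ω` at a preliminary estimate `β₀`, with
`n / N` and `n' / N`, `N = n + n'`, in place of `τ` and `τ'`. -/
def momentVarHat (n n' : ℕ) (I : ℕ → Fin m → ℝ) (Y : ℕ → ℝ)
    (I' : ℕ → Fin m → ℝ) (X' : ℕ → Fin d → ℝ) (β₀ : EuclideanSpace ℝ (Fin d)) :
    Matrix (Fin m) (Fin m) ℝ :=
  ((n : ℝ) / ((n : ℝ) + n'))⁻¹ • empVar n (fun i => Y i • I i) +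
    ((n' : ℝ) / ((n : ℝ) + n'))⁻¹ • empVar n' (fun j => (X' j ⬝ᵥ β₀.ofLp) • I' j)

/-- The empirical version of `V(Ω⁻¹)`. -/
def asymVarHat (n n' : ℕ) (I : ℕ → Fin m → ℝ) (Y : ℕ → ℝ)
    (I' : ℕ → Fin m → ℝ) (X' : ℕ → Fin d → ℝ) (β₀ : EuclideanSpace ℝ (Fin d)) :
    Matrix (Fin d) (Fin d) ℝ :=
  sandwich (momentIX n' I' X') (momentVarHat n n' I Y I' X' β₀)
    (momentVarHat n n' I Y I' X' β₀)⁻¹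

/-- `A ^ (-1/2)` for a symmetric positive definite matrix, by functional calculus. -/
def invSqrt (A : Matrix (Fin d) (Fin d) ℝ) : Matrix (Fin d) (Fin d) ℝ :=
  cfc (fun x : ℝ => (√x)⁻¹) A

end UnpairedIV

end

/-!
When `CᵀWC` is invertible, the minimizer of `(g - C b)ᵀ W (g - C b)` is `(CᵀWC)⁻¹CᵀW g`. Applied to
`Ĉ` and `W_N`, whose Gram matrix `ĈᵀW_NĈ` is invertible with probability tending to one, this gives
`β̂ - β = (ĈᵀW_NĈ)⁻¹ĈᵀW_N ĝ(β)`. By exogeneity `ĝ(β)` is a difference of averages, with the same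
mean, over two independent samples, so the law of large numbers gives consistency and the central
limit theorem for each sample gives the limiting variance `Ω` of `√N ĝ(β)`; Slutsky's lemma then
produces the sandwich matrix. Centering the observations changes an average of products only by a
product of two sample means, which is of smaller order than `N^(-1/2)`.

Optimality of `Ω⁻¹` is the Gauss–Markov argument: every left inverse `M` of `C` satisfies
`MΩMᵀ - (CᵀΩ⁻¹C)⁻¹ = DΩDᵀ`, where `D = M - (CᵀΩ⁻¹C)⁻¹CᵀΩ⁻¹`.
-/

noncomputable section

namespace UnpairedIV

section Algebra

variable {ι κ : Type*}

theorem transpose_eq_of_posDef {W : Matrix ι ι ℝ} (hW : W.PosDef) : Wᵀ = W := by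
  simpa using hW.1.eq

variable [Fintype κ]

theorem mulVec_injective_of_rank_eq_card {C : Matrix ι κ ℝ} (h : C.rank = Fintype.card κ) :
    Function.Injective C.mulVec := by
  rw [Matrix.mulVec_injective_iff, linearIndependent_iff_card_eq_finrank_span, Set.finrank,
    ← Matrix.rank_eq_finrank_span_cols, h]

theorem posDef_gram [Fintype ι] {C : Matrix ι κ ℝ} {W : Matrix ι ι ℝ}
    (hC : Function.Injective C.mulVec) (hW : W.PosDef) : (Cᵀ * W * C).PosDef := by
  simpa using hW.conjTranspose_mul_mul_same hC

variable [Fintype ι] [DecidableEq κ]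

/-- The matrix `(CᵀWC)⁻¹CᵀW` of the weighted least squares problem with design `C` and weight `W`;
it maps the sample moment at `β` to the estimation error of the GMM estimator. -/
def gmmMatrix (C : Matrix ι κ ℝ) (W : Matrix ι ι ℝ) : Matrix κ ι ℝ :=
  (Cᵀ * W * C)⁻¹ * (Cᵀ * W)

theorem posDef_gram_of_det_ne_zero {C : Matrix ι κ ℝ} {W : Matrix ι ι ℝ} (hW : W.PosDef)
    (h : (Cᵀ * W * C).det ≠ 0) : (Cᵀ * W * C).PosDef := by
  have hpsd : (Cᵀ * W * C).PosSemidef := by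
    simpa using hW.posSemidef.conjTranspose_mul_mul_same C
  exact hpsd.posDef_iff_det_ne_zero.2 h

theorem gmmMatrix_mul {C : Matrix ι κ ℝ} {W : Matrix ι ι ℝ} (h : (Cᵀ * W * C).det ≠ 0) :
    gmmMatrix C W * C = 1 := by
  rw [gmmMatrix, Matrix.mul_assoc, nonsing_inv_mul _ h.isUnit]

theorem transpose_mulVec_residual_eq_zero {C : Matrix ι κ ℝ} {W : Matrix ι ι ℝ}
    (h : (Cᵀ * W * C).det ≠ 0) (g : ι → ℝ) :
    Cᵀ *ᵥ W *ᵥ (g - C *ᵥ gmmMatrix C W *ᵥ g) = 0 := by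
  have projection : Cᵀ * W * C * gmmMatrix C W = Cᵀ * W := by
    rw [gmmMatrix, ← Matrix.mul_assoc, mul_nonsing_inv _ h.isUnit, Matrix.one_mul]
  simp only [mulVec_sub, mulVec_mulVec, ← Matrix.mul_assoc, projection, sub_self]

theorem residual_form_eq_add {C : Matrix ι κ ℝ} {W : Matrix ι ι ℝ} (hW : Wᵀ = W)
    (h : (Cᵀ * W * C).det ≠ 0) (g : ι → ℝ) (u : κ → ℝ) :
    (g - C *ᵥ (gmmMatrix C W *ᵥ g + u)) ⬝ᵥ W *ᵥ (g - C *ᵥ (gmmMatrix C W *ᵥ g + u)) =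
      (g - C *ᵥ gmmMatrix C W *ᵥ g) ⬝ᵥ W *ᵥ (g - C *ᵥ gmmMatrix C W *ᵥ g) +
        u ⬝ᵥ (Cᵀ * W * C) *ᵥ u := by
  rw [mulVec_add, ← sub_sub]
  have normal := transpose_mulVec_residual_eq_zero h g
  set r := g - C *ᵥ gmmMatrix C W *ᵥ g
  have left_cross : (C *ᵥ u) ⬝ᵥ W *ᵥ r = 0 := by
    rw [dotProduct_comm, dotProduct_mulVec, ← mulVec_transpose, normal, zero_dotProduct]
  have right_cross : r ⬝ᵥ W *ᵥ (C *ᵥ u) = 0 := by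
    rw [dotProduct_mulVec, ← mulVec_transpose, hW, dotProduct_comm, left_cross]
  have gram : (C *ᵥ u) ⬝ᵥ W *ᵥ (C *ᵥ u) = u ⬝ᵥ (Cᵀ * W * C) *ᵥ u := by
    rw [← mulVec_mulVec, ← mulVec_mulVec, dotProduct_mulVec u, vecMul_transpose]
  rw [mulVec_sub W r, sub_dotProduct, dotProduct_sub, dotProduct_sub, left_cross, right_cross, gram]
  ring

theorem eq_gmmMatrix_mulVec_of_isMinOn {C : Matrix ι κ ℝ} {W : Matrix ι ι ℝ} (hW : W.PosDef)
    (h : (Cᵀ * W * C).det ≠ 0) {g : ι → ℝ} {w : κ → ℝ}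
    (hw : IsMinOn (fun w => (g - C *ᵥ w) ⬝ᵥ W *ᵥ (g - C *ᵥ w)) Set.univ w) :
    w = gmmMatrix C W *ᵥ g := by
  by_contra hne
  have hpos := (posDef_gram_of_det_ne_zero hW h).dotProduct_mulVec_pos (sub_ne_zero.2 hne)
  have hmin : (g - C *ᵥ w) ⬝ᵥ W *ᵥ (g - C *ᵥ w) ≤ _ := hw (Set.mem_univ (gmmMatrix C W *ᵥ g))
  have expansion := residual_form_eq_add (transpose_eq_of_posDef hW) h g (w - gmmMatrix C W *ᵥ g)
  rw [add_sub_cancel] at expansion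
  simp only [star_trivial] at hpos
  linarith

section GaussMarkov

variable [DecidableEq ι]

theorem gmmMatrix_inv_mul_mul_transpose {C : Matrix ι κ ℝ} {Ω : Matrix ι ι ℝ} (hΩ : Ω.PosDef)
    {M : Matrix κ ι ℝ} (hM : M * C = 1) :
    gmmMatrix C Ω⁻¹ * Ω * Mᵀ = (Cᵀ * Ω⁻¹ * C)⁻¹ := by
  rw [gmmMatrix, Matrix.mul_assoc _ _ Ω, Matrix.mul_assoc _ _ Ω,
    nonsing_inv_mul _ hΩ.det_pos.ne'.isUnit, Matrix.mul_one, Matrix.mul_assoc, ← transpose_mul, hM,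
    transpose_one, Matrix.mul_one]

theorem sub_eq_mul_mul_transpose_of_mul_eq_one {C : Matrix ι κ ℝ} {Ω : Matrix ι ι ℝ}
    (hΩ : Ω.PosDef) (h : (Cᵀ * Ω⁻¹ * C).det ≠ 0) {M : Matrix κ ι ℝ} (hM : M * C = 1) :
    M * Ω * Mᵀ - (Cᵀ * Ω⁻¹ * C)⁻¹ =
      (M - gmmMatrix C Ω⁻¹) * Ω * (M - gmmMatrix C Ω⁻¹)ᵀ := by
  have efficient_self := gmmMatrix_inv_mul_mul_transpose hΩ (gmmMatrix_mul h)
  have efficient_left := gmmMatrix_inv_mul_mul_transpose hΩ hM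
  have efficient_right : M * Ω * (gmmMatrix C Ω⁻¹)ᵀ = (Cᵀ * Ω⁻¹ * C)⁻¹ := by
    rw [← transpose_eq_of_posDef (posDef_gram_of_det_ne_zero hΩ.inv h).inv, ← efficient_left,
      transpose_mul, transpose_mul, transpose_transpose, transpose_eq_of_posDef hΩ,
      Matrix.mul_assoc]
  rw [transpose_sub, Matrix.sub_mul, Matrix.sub_mul, Matrix.mul_sub, Matrix.mul_sub, efficient_self,
    efficient_left, efficient_right]
  abel

end GaussMarkov

end Algebra

section Sandwich

variable {m d : ℕ} {C : Matrix (Fin m) (Fin d) ℝ} {Ω W : Matrix (Fin m) (Fin m) ℝ}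

theorem sandwich_eq (hW : Wᵀ = W) :
    sandwich C Ω W = gmmMatrix C W * Ω * (gmmMatrix C W)ᵀ := by
  simp only [sandwich, gmmMatrix, transpose_mul, transpose_transpose, transpose_nonsing_inv, hW,
    Matrix.mul_assoc]

theorem sandwich_inv (hΩ : Ω.det ≠ 0) (h : (Cᵀ * Ω⁻¹ * C).det ≠ 0) :
    sandwich C Ω Ω⁻¹ = (Cᵀ * Ω⁻¹ * C)⁻¹ := by
  rw [sandwich, Matrix.mul_assoc Cᵀ Ω⁻¹ Ω, nonsing_inv_mul _ hΩ.isUnit, Matrix.mul_one,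
    nonsing_inv_mul _ h.isUnit, Matrix.one_mul]

theorem posDef_sandwich_inv (hΩ : Ω.PosDef) (h : (Cᵀ * Ω⁻¹ * C).det ≠ 0) :
    (sandwich C Ω Ω⁻¹).PosDef := by
  rw [sandwich_inv hΩ.det_pos.ne' h]
  exact (posDef_gram_of_det_ne_zero hΩ.inv h).inv

theorem sandwich_inv_eq_zero_or_posDef (hΩ : Ω.PosSemidef) :
    sandwich C Ω Ω⁻¹ = 0 ∨ (sandwich C Ω Ω⁻¹).PosDef := by
  by_cases hdet : Ω.det = 0
  · left
    simp [sandwich, nonsing_inv_apply_not_isUnit Ω (by simp [hdet])]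
  by_cases hgram : (Cᵀ * Ω⁻¹ * C).det = 0
  · left
    simp [sandwich, nonsing_inv_apply_not_isUnit (Cᵀ * Ω⁻¹ * C) (by simp [hgram])]
  · exact .inr (posDef_sandwich_inv (hΩ.posDef_iff_det_ne_zero.2 hdet) hgram)

theorem posSemidef_sandwich_sub (hC : C.rank = d) (hΩ : Ω.PosDef) (hW : W.PosDef) :
    (sandwich C Ω W - sandwich C Ω Ω⁻¹).PosSemidef := by
  have hinj := mulVec_injective_of_rank_eq_card (hC.trans (Fintype.card_fin d).symm)
  have hgram := (posDef_gram hinj hΩ.inv).det_pos.ne'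
  rw [sandwich_eq (transpose_eq_of_posDef hW), sandwich_inv hΩ.det_pos.ne' hgram,
    sub_eq_mul_mul_transpose_of_mul_eq_one hΩ hgram
      (gmmMatrix_mul (posDef_gram hinj hW).det_pos.ne')]
  simpa using hΩ.posSemidef.mul_mul_conjTranspose_same (gmmMatrix C W - gmmMatrix C Ω⁻¹)

end Sandwich

section InverseSquareRoot

variable {d : ℕ} {A : Matrix (Fin d) (Fin d) ℝ}

theorem spectrum_subset_Ioi_of_posDef (hA : A.PosDef) : spectrum ℝ A ⊆ Set.Ioi 0 := by
  rw [hA.1.spectrum_real_eq_range_eigenvalues]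
  rintro _ ⟨i, rfl⟩
  exact hA.eigenvalues_pos i

theorem invSqrt_zero : invSqrt (0 : Matrix (Fin d) (Fin d) ℝ) = 0 := by
  simp [invSqrt, cfc_apply_zero]

theorem transpose_invSqrt : (invSqrt A)ᵀ = invSqrt A := by
  rw [← conjTranspose_eq_transpose_of_trivial]
  exact (cfc_predicate (R := ℝ) (p := IsSelfAdjoint) _ A).star_eq

theorem invSqrt_mul_mul_invSqrt (hA : A.PosDef) : invSqrt A * A * invSqrt A = 1 := by
  have hsa : IsSelfAdjoint A := hA.1
  have hcont (f : ℝ → ℝ) : ContinuousOn f (spectrum ℝ A) := A.finite_real_spectrum.continuousOn f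
  have hscalar : ∀ x ∈ spectrum ℝ A, (√x)⁻¹ * x * (√x)⁻¹ = 1 := fun x hx => by
    have hx0 : 0 < x := spectrum_subset_Ioi_of_posDef hA hx
    rw [mul_right_comm, ← mul_inv, Real.mul_self_sqrt hx0.le, inv_mul_cancel₀ hx0.ne']
  calc invSqrt A * A * invSqrt A
      = cfc (fun x : ℝ => (√x)⁻¹ * x * (√x)⁻¹) A := by
        rw [cfc_mul _ _ A (hcont _) (hcont _), cfc_mul _ _ A (hcont _) (hcont _), cfc_id' ℝ A]
        rfl
    _ = 1 := by rw [cfc_congr (g := 1) hscalar, cfc_one ℝ A]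

open scoped Matrix.Norms.L2Operator in
theorem continuousOn_invSqrt : ContinuousOn (invSqrt (d := d)) {A | A.PosDef} := by
  refine ContinuousOn.cfc_of_mem_nhdsSet (s := Set.Ioi (0 : ℝ)) _ ?_ continuousOn_id
    (fun A hA => hA.1) ?_
  · rw [isOpen_Ioi.mem_nhdsSet]
    exact Set.iUnion₂_subset fun A hA => spectrum_subset_Ioi_of_posDef hA
  · exact fun x hx => (Real.continuous_sqrt.continuousAt.inv₀
      (Real.sqrt_pos.2 hx).ne').continuousWithinAt

end InverseSquareRoot

section MatrixLimits

variable {α ι κ ρ : Type*} [Fintype ι] {l : Filter α}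

theorem tendsto_matrix_mul {A : α → Matrix κ ι ℝ} {B : α → Matrix ι ρ ℝ} {A₀ : Matrix κ ι ℝ}
    {B₀ : Matrix ι ρ ℝ} (hA : Tendsto A l (𝓝 A₀)) (hB : Tendsto B l (𝓝 B₀)) :
    Tendsto (fun x => A x * B x) l (𝓝 (A₀ * B₀)) :=
  ((continuous_fst.matrix_mul continuous_snd).tendsto (A₀, B₀)).comp (hA.prodMk_nhds hB)

theorem tendsto_matrix_mulVec {A : α → Matrix κ ι ℝ} {v : α → ι → ℝ} {A₀ : Matrix κ ι ℝ}
    {v₀ : ι → ℝ} (hA : Tendsto A l (𝓝 A₀)) (hv : Tendsto v l (𝓝 v₀)) :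
    Tendsto (fun x => A x *ᵥ v x) l (𝓝 (A₀ *ᵥ v₀)) :=
  ((continuous_fst.matrix_mulVec continuous_snd).tendsto (A₀, v₀)).comp (hA.prodMk_nhds hv)

theorem tendsto_matrix_det [DecidableEq ι] {A : α → Matrix ι ι ℝ} {A₀ : Matrix ι ι ℝ}
    (hA : Tendsto A l (𝓝 A₀)) : Tendsto (fun x => (A x).det) l (𝓝 A₀.det) :=
  (continuous_id.matrix_det.tendsto A₀).comp hA

theorem tendsto_matrix_inv [DecidableEq ι] {A : α → Matrix ι ι ℝ} {A₀ : Matrix ι ι ℝ}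
    (hA : Tendsto A l (𝓝 A₀)) (h0 : A₀.det ≠ 0) : Tendsto (fun x => (A x)⁻¹) l (𝓝 A₀⁻¹) :=
  (continuousAt_matrix_inv A₀ (by simpa using continuousAt_inv₀ h0)).tendsto.comp hA

variable {C : α → Matrix ι κ ℝ} {W : α → Matrix ι ι ℝ} {C₀ : Matrix ι κ ℝ} {W₀ : Matrix ι ι ℝ}

theorem tendsto_transpose_mul (hC : Tendsto C l (𝓝 C₀)) (hW : Tendsto W l (𝓝 W₀)) :
    Tendsto (fun x => (C x)ᵀ * W x) l (𝓝 (C₀ᵀ * W₀)) :=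
  tendsto_matrix_mul ((continuous_id.matrix_transpose.tendsto C₀).comp hC) hW

theorem tendsto_gram (hC : Tendsto C l (𝓝 C₀)) (hW : Tendsto W l (𝓝 W₀)) :
    Tendsto (fun x => (C x)ᵀ * W x * C x) l (𝓝 (C₀ᵀ * W₀ * C₀)) :=
  tendsto_matrix_mul (tendsto_transpose_mul hC hW) hC

theorem tendsto_gmmMatrix [Fintype κ] [DecidableEq κ] (hC : Tendsto C l (𝓝 C₀))
    (hW : Tendsto W l (𝓝 W₀)) (h0 : (C₀ᵀ * W₀ * C₀).det ≠ 0) :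
    Tendsto (fun x => gmmMatrix (C x) (W x)) l (𝓝 (gmmMatrix C₀ W₀)) :=
  tendsto_matrix_mul (tendsto_matrix_inv (tendsto_gram hC hW) h0) (tendsto_transpose_mul hC hW)

end MatrixLimits

section SandwichLimits

variable {α : Type*} {l : Filter α} {m d : ℕ} {C : α → Matrix (Fin m) (Fin d) ℝ}
  {A W : α → Matrix (Fin m) (Fin m) ℝ} {C₀ : Matrix (Fin m) (Fin d) ℝ}
  {A₀ W₀ : Matrix (Fin m) (Fin m) ℝ}

theorem tendsto_sandwich (hC : Tendsto C l (𝓝 C₀)) (hA : Tendsto A l (𝓝 A₀))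
    (hW : Tendsto W l (𝓝 W₀)) (h0 : (C₀ᵀ * W₀ * C₀).det ≠ 0) :
    Tendsto (fun x => sandwich (C x) (A x) (W x)) l (𝓝 (sandwich C₀ A₀ W₀)) := by
  have hinv := tendsto_matrix_inv (tendsto_gram hC hW) h0
  exact tendsto_matrix_mul (tendsto_matrix_mul hinv (tendsto_matrix_mul
    (tendsto_matrix_mul (tendsto_matrix_mul (tendsto_transpose_mul hC hW) hA) hW) hC)) hinv

theorem tendsto_invSqrt_sandwich_inv (hC : Tendsto C l (𝓝 C₀)) (hA : Tendsto A l (𝓝 A₀))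
    (hpsd : ∀ x, (A x).PosSemidef) (hA₀ : A₀.PosDef) (h0 : (C₀ᵀ * A₀⁻¹ * C₀).det ≠ 0) :
    Tendsto (fun x => invSqrt (sandwich (C x) (A x) (A x)⁻¹)) l
      (𝓝 (invSqrt (sandwich C₀ A₀ A₀⁻¹))) := by
  have hdet := hA₀.det_pos.ne'
  have hAinv := tendsto_matrix_inv hA hdet
  refine (continuousOn_invSqrt _ (posDef_sandwich_inv hA₀ h0)).tendsto.comp
    (tendsto_nhdsWithin_iff.2 ⟨tendsto_sandwich hC hA hAinv h0, ?_⟩)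
  filter_upwards [(tendsto_matrix_det hA).eventually_ne hdet,
    (tendsto_matrix_det (tendsto_gram hC hAinv)).eventually_ne h0] with x hAx hgram
  exact posDef_sandwich_inv ((hpsd x).posDef_iff_det_ne_zero.2 hAx) hgram

end SandwichLimits

section MatrixMeasurability

variable {ι κ ρ : Type*}

scoped instance : MeasurableSpace (Matrix ι κ ℝ) :=
  inferInstanceAs (MeasurableSpace (ι → κ → ℝ))
scoped instance [Countable ι] [Countable κ] : BorelSpace (Matrix ι κ ℝ) :=
  inferInstanceAs (BorelSpace (ι → κ → ℝ))
scoped instance [Countable ι] [Countable κ] : SecondCountableTopology (Matrix ι κ ℝ) :=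
  inferInstanceAs (SecondCountableTopology (ι → κ → ℝ))
scoped instance [Countable ι] [Countable κ] :
    TopologicalSpace.PseudoMetrizableSpace (Matrix ι κ ℝ) :=
  inferInstanceAs (TopologicalSpace.PseudoMetrizableSpace (ι → κ → ℝ))

theorem measurable_matrix_inv [Fintype ι] [DecidableEq ι] :
    Measurable fun A : Matrix ι ι ℝ => A⁻¹ := by
  simp_rw [Matrix.inv_def, Ring.inverse_eq_inv']
  exact continuous_id.matrix_det.measurable.inv.smul continuous_id.matrix_adjugate.measurable

theorem measurableSet_posSemidef [Finite ι] :
    MeasurableSet {A : Matrix ι ι ℝ | A.PosSemidef} := by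
  cases nonempty_fintype ι
  simp only [posSemidef_iff_dotProduct_mulVec, Set.ofPred_and, Set.ofPred_forall]
  exact ((isClosed_eq continuous_id.matrix_conjTranspose continuous_id).inter
    (isClosed_iInter fun x => isClosed_le continuous_const
      (continuous_const.dotProduct (continuous_id.matrix_mulVec continuous_const)))).measurableSet

theorem measurableSet_posDef [Finite ι] : MeasurableSet {A : Matrix ι ι ℝ | A.PosDef} := by
  classical
  cases nonempty_fintype ι
  have posDef_iff (A : Matrix ι ι ℝ) : A.PosDef ↔ A.PosSemidef ∧ A.det ≠ 0 :=
    ⟨fun h => ⟨h.posSemidef, h.det_pos.ne'⟩, fun h => h.1.posDef_iff_det_ne_zero.2 h.2⟩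
  simp only [posDef_iff, Set.ofPred_and]
  exact measurableSet_posSemidef.inter
    (isOpen_ne_fun continuous_id.matrix_det continuous_const).measurableSet

theorem measurable_indicator_invSqrt {d : ℕ} :
    Measurable (({A | A.PosDef} : Set (Matrix (Fin d) (Fin d) ℝ)).indicator invSqrt) := by
  classical
  rw [← Set.piecewise_eq_indicator]
  exact continuousOn_invSqrt.measurable_piecewise continuousOn_const measurableSet_posDef

theorem indicator_invSqrt_eq {d : ℕ} {A : Matrix (Fin d) (Fin d) ℝ} (hA : A = 0 ∨ A.PosDef) :
    ({A | A.PosDef} : Set (Matrix (Fin d) (Fin d) ℝ)).indicator invSqrt A = invSqrt A := by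
  rcases hA with rfl | hA
  · exact Set.indicator_apply_eq_self.2 fun _ => invSqrt_zero
  · exact Set.indicator_of_mem (Set.mem_ofPred.2 hA) _

variable {Ω : Type*} [MeasurableSpace Ω] {P : Measure Ω}

theorem aemeasurable_matrix_mul [Countable ι] [Fintype κ] [Countable ρ] {A : Ω → Matrix ι κ ℝ}
    {B : Ω → Matrix κ ρ ℝ} (hA : AEMeasurable A P) (hB : AEMeasurable B P) :
    AEMeasurable (fun ω => A ω * B ω) P :=
  (continuous_fst.matrix_mul continuous_snd).measurable.comp_aemeasurable (hA.prodMk hB)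

theorem aemeasurable_transpose_mul [Fintype ι] [Countable κ] {C : Ω → Matrix ι κ ℝ}
    {W : Ω → Matrix ι ι ℝ} (hC : AEMeasurable C P) (hW : AEMeasurable W P) :
    AEMeasurable (fun ω => (C ω)ᵀ * W ω) P :=
  aemeasurable_matrix_mul (continuous_id.matrix_transpose.measurable.comp_aemeasurable hC) hW

theorem aemeasurable_gmmMatrix [Fintype ι] [Fintype κ] [DecidableEq κ] {C : Ω → Matrix ι κ ℝ}
    {W : Ω → Matrix ι ι ℝ} (hC : AEMeasurable C P) (hW : AEMeasurable W P) :
    AEMeasurable (fun ω => gmmMatrix (C ω) (W ω)) P := by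
  have hCW := aemeasurable_transpose_mul hC hW
  exact aemeasurable_matrix_mul
    (measurable_matrix_inv.comp_aemeasurable (aemeasurable_matrix_mul hCW hC)) hCW

theorem aemeasurable_sandwich {m d : ℕ} {C : Ω → Matrix (Fin m) (Fin d) ℝ}
    {A W : Ω → Matrix (Fin m) (Fin m) ℝ} (hC : AEMeasurable C P) (hA : AEMeasurable A P)
    (hW : AEMeasurable W P) : AEMeasurable (fun ω => sandwich (C ω) (A ω) (W ω)) P := by
  have hCW := aemeasurable_transpose_mul hC hW
  have hinv := measurable_matrix_inv.comp_aemeasurable (aemeasurable_matrix_mul hCW hC)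
  exact aemeasurable_matrix_mul (aemeasurable_matrix_mul hinv (aemeasurable_matrix_mul
    (aemeasurable_matrix_mul (aemeasurable_matrix_mul hCW hA) hW) hC)) hinv

theorem aemeasurable_invSqrt_sandwich_inv {m d : ℕ} {C : Ω → Matrix (Fin m) (Fin d) ℝ}
    {A : Ω → Matrix (Fin m) (Fin m) ℝ} (hC : AEMeasurable C P) (hA : AEMeasurable A P)
    (hpsd : ∀ ω, (A ω).PosSemidef) :
    AEMeasurable (fun ω => invSqrt (sandwich (C ω) (A ω) (A ω)⁻¹)) P := by
  simp_rw [← fun ω => indicator_invSqrt_eq (sandwich_inv_eq_zero_or_posDef (C := C ω) (hpsd ω))]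
  exact measurable_indicator_invSqrt.comp_aemeasurable
    (aemeasurable_sandwich hC hA (measurable_matrix_inv.comp_aemeasurable hA))

end MatrixMeasurability

section ConvergenceInProbability

variable {Ω κ : Type*} [MeasurableSpace Ω] {l : Filter κ} {P : Measure Ω}

/-- The filter of families of events whose probability tends to one along `l`, a family being
encoded as a set of pairs of an index and an outcome: convergence in probability to a constant is
convergence along this filter, so that it is compatible with all continuous operations. -/
def inProb (l : Filter κ) (P : Measure Ω) : Filter (κ × Ω) :=
  .comk (fun A => Tendsto (fun k => P {ω | (k, ω) ∈ A}) l (𝓝 0))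
    (by simp [tendsto_const_nhds])
    (fun _ hA _ hBA => tendsto_of_tendsto_of_tendsto_of_le_of_le tendsto_const_nhds hA
      (fun _ => zero_le) fun _ => measure_mono fun _ hω => hBA hω)
    (fun _ hA _ hB => tendsto_of_tendsto_of_tendsto_of_le_of_le tendsto_const_nhds
      ((hA.add hB).trans (by simp)) (fun _ => zero_le) fun _ => measure_union_le _ _)

theorem eventually_inProb {Q : κ × Ω → Prop} :
    (∀ᶠ p in inProb l P, Q p) ↔ Tendsto (fun k => P {ω | ¬ Q (k, ω)}) l (𝓝 0) :=
  Iff.rfl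

theorem tendstoInMeasure_const_iff {E : Type*} [PseudoEMetricSpace E] {f : κ → Ω → E} {c : E} :
    TendstoInMeasure P f l (fun _ => c) ↔
      Tendsto (fun p : κ × Ω => f p.1 p.2) (inProb l P) (𝓝 c) := by
  rw [Metric.nhds_basis_eball.tendsto_right_iff]
  simp only [TendstoInMeasure, eventually_inProb, Metric.mem_eball, not_lt]

theorem tendsto_fst_inProb : Tendsto Prod.fst (inProb l P) l := fun A hA =>
  eventually_inProb.2 (tendsto_const_nhds.congr' (by
    filter_upwards [hA] with k hk
    simp [hk]))

theorem eventually_inProb_of_ae {Q : κ → Ω → Prop} (h : ∀ k, ∀ᵐ ω ∂P, Q k ω) :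
    ∀ᶠ p in inProb l P, Q p.1 p.2 :=
  eventually_inProb.2 (tendsto_const_nhds.congr fun k => (ae_iff.1 (h k)).symm)

theorem eventually_inProb_of_tendsto_one [IsProbabilityMeasure P] {s : κ → Set Ω}
    (hs : ∀ k, NullMeasurableSet (s k) P) (h : Tendsto (fun k => P (s k)) l (𝓝 1)) :
    ∀ᶠ p in inProb l P, p.2 ∈ s p.1 := by
  have hcompl : Tendsto (fun k => 1 - P (s k)) l (𝓝 0) := by
    simpa using ENNReal.Tendsto.sub (tendsto_const_nhds (x := 1)) h (.inl ENNReal.one_ne_top)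
  exact eventually_inProb.2 (hcompl.congr fun k => (prob_compl_eq_one_sub₀ (hs k)).symm)

theorem tendsto_inProb_of_ae [IsFiniteMeasure P] {E : Type*} [PseudoEMetricSpace E] {f : ℕ → Ω → E}
    {c : E} (hf : ∀ k, AEStronglyMeasurable (f k) P)
    (h : ∀ᵐ ω ∂P, Tendsto (fun k => f k ω) atTop (𝓝 c)) :
    Tendsto (fun p : ℕ × Ω => f p.1 p.2) (inProb atTop P) (𝓝 c) :=
  tendstoInMeasure_const_iff.1 (tendstoInMeasure_of_tendsto_ae hf h)

variable [IsProbabilityMeasure P] {Ω' : Type*} [MeasurableSpace Ω'] {ν : Measure Ω'}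
  [IsProbabilityMeasure ν]

theorem tendstoInDistribution_congr_limit {Ω'' E : Type*} [MeasurableSpace Ω''] {ρ : Measure Ω''}
    [IsProbabilityMeasure ρ] [TopologicalSpace E] [MeasurableSpace E] [OpensMeasurableSpace E]
    {X : κ → Ω → E} {Z : Ω' → E} {Z' : Ω'' → E} (h : TendstoInDistribution X l Z (fun _ => P) ν)
    (hZ' : AEMeasurable Z' ρ) (hlaw : ν.map Z = ρ.map Z') :
    TendstoInDistribution X l Z' (fun _ => P) ρ := by
  refine ⟨h.forall_aemeasurable, hZ', ?_⟩
  simpa only [hlaw] using h.tendsto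

theorem tendstoInDistribution_of_eventually_eq [l.IsCountablyGenerated] {E : Type*}
    [NormedAddCommGroup E] [SecondCountableTopology E] [MeasurableSpace E] [BorelSpace E]
    {X Y : κ → Ω → E} {Z : Ω' → E} (h : TendstoInDistribution X l Z (fun _ => P) ν)
    (hY : ∀ k, AEMeasurable (Y k) P) (hXY : ∀ᶠ p in inProb l P, Y p.1 p.2 = X p.1 p.2) :
    TendstoInDistribution Y l Z (fun _ => P) ν := by
  refine tendstoInDistribution_of_tendstoInMeasure_sub Y Z h
    (tendstoInMeasure_const_iff (c := (0 : E)) |>.2 (tendsto_const_nhds.congr' ?_)) hY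
  filter_upwards [hXY] with p hp
  simp [hp]

theorem tendsto_inProb_of_tendstoInDistribution_const {E : Type*} [PseudoEMetricSpace E]
    [MeasurableSpace E] [BorelSpace E] {X : κ → Ω → E} {c : E}
    (h : TendstoInDistribution X l (fun _ : Ω' => c) (fun _ => P) ν) :
    Tendsto (fun p : κ × Ω => X p.1 p.2) (inProb l P) (𝓝 c) := by
  refine tendstoInMeasure_const_iff.1 fun ε hε => ?_
  have hclosed : IsClosed {x : E | ε ≤ edist x c} :=
    isClosed_le continuous_const (continuous_id.edist continuous_const)
  have hlimit : ν.map (fun _ => c) {x : E | ε ≤ edist x c} = 0 := by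
    rw [Measure.map_apply measurable_const hclosed.measurableSet]
    simp [hε.not_ge]
  have hlimsup := ProbabilityMeasure.limsup_measure_closed_le_of_tendsto h.tendsto hclosed
  simp only [ProbabilityMeasure.coe_mk, hlimit] at hlimsup
  refine (tendsto_of_le_liminf_of_limsup_le zero_le hlimsup).congr fun k => ?_
  rw [Measure.map_apply_of_aemeasurable (h.forall_aemeasurable k) hclosed.measurableSet]
  rfl

end ConvergenceInProbability

section Averages

variable {E F G : Type*} [AddCommGroup E] [Module ℝ E] [AddCommGroup F] [Module ℝ F]
  [AddCommGroup G] [Module ℝ G]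

theorem map_avg (φ : E →ₗ[ℝ] F) (n : ℕ) (v : ℕ → E) :
    φ (avg n v) = avg n fun i => φ (v i) := by
  simp only [avg, map_smul, map_sum]

theorem map_obs (φ : E →ₗ[ℝ] F) (c : Centering) (n : ℕ) (v : ℕ → E) (i : ℕ) :
    φ (c.obs n v i) = c.obs n (fun i => φ (v i)) i := by
  cases c <;> simp only [Centering.obs, map_sub, map_avg]

theorem avg_apply {ι : Type*} (n : ℕ) (v : ℕ → ι → ℝ) (a : ι) :
    avg n v a = avg n fun i => v i a :=
  map_avg (LinearMap.proj a) n v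

theorem obs_apply {ι : Type*} (c : Centering) (n : ℕ) (v : ℕ → ι → ℝ) (i : ℕ) (a : ι) :
    c.obs n v i a = c.obs n (fun i => v i a) i :=
  map_obs (LinearMap.proj a) c n v i

theorem avg_sub (n : ℕ) (u v : ℕ → E) :
    avg n (fun i => u i - v i) = avg n u - avg n v := by
  simp only [avg, Finset.sum_sub_distrib, smul_sub]

theorem avg_sum {κ : Type*} (s : Finset κ) (n : ℕ) (u : κ → ℕ → E) :
    avg n (fun i => ∑ t ∈ s, u t i) = ∑ t ∈ s, avg n (u t) := by
  simp only [avg, Finset.sum_comm (t := s), Finset.smul_sum]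

theorem avg_const {n : ℕ} (hn : n ≠ 0) (e : E) : avg n (fun _ => e) = e := by
  rw [avg, Finset.sum_const, Finset.card_range, ← Nat.cast_smul_eq_nsmul ℝ,
    inv_smul_smul₀ (Nat.cast_ne_zero.2 hn)]

theorem avg_mul_const (n : ℕ) (u : ℕ → ℝ) (c : ℝ) : avg n (fun i => u i * c) = avg n u * c :=
  (map_avg (LinearMap.mulRight ℝ c) n u).symm

theorem avg_bilin_sub_avg (B : E →ₗ[ℝ] F →ₗ[ℝ] G) (n : ℕ) (u : ℕ → E) (v : ℕ → F) :
    avg n (fun i => B (u i - avg n u) (v i - avg n v)) =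
      avg n (fun i => B (u i) (v i)) - B (avg n u) (avg n v) := by
  rcases eq_or_ne n 0 with rfl | hn
  · simp [avg]
  · have hright : avg n (fun i => B (u i) (avg n v)) = B (avg n u) (avg n v) :=
      (map_avg (B.flip (avg n v)) n u).symm
    simp only [map_sub, LinearMap.sub_apply, avg_sub, avg_const hn, hright, ← map_avg]
    abel

theorem tendsto_avg_prod_obs {α ι : Type*} [Fintype ι] {l : Filter α} (c : Centering) {n : α → ℕ}
    {u : α → ι → ℕ → ℝ} {L : Finset ι → ℝ}
    (hprod : ∀ t, Tendsto (fun x => avg (n x) fun i => ∏ j ∈ t, u x j i) l (𝓝 (L t)))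
    (hmean : ∀ j, Tendsto (fun x => avg (n x) (u x j)) l (𝓝 0)) :
    Tendsto (fun x => avg (n x) fun i => ∏ j, c.obs (n x) (u x j) i) l
      (𝓝 (L Finset.univ)) := by
  classical
  cases c with
  | population => exact hprod Finset.univ
  | sampleMean =>
    have hexpand : ∀ x, (avg (n x) fun i => ∏ j, Centering.sampleMean.obs (n x) (u x j) i) =
        ∑ t : Finset ι, avg (n x) (fun i => ∏ j ∈ t, u x j i) *
          ∏ j ∈ Finset.univ \ t, -avg (n x) (u x j) := fun x => by
      simp only [Centering.obs, sub_eq_add_neg, Finset.prod_add, avg_sum, avg_mul_const,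
        Finset.powerset_univ]
    have hlimit : ∑ t : Finset ι, L t * ∏ _j ∈ Finset.univ \ t, (-0 : ℝ) = L Finset.univ := by
      rw [Finset.sum_eq_single_of_mem Finset.univ (Finset.mem_univ _) fun t _ ht => ?_]
      · simp
      · obtain ⟨j, hj⟩ : (Finset.univ \ t).Nonempty :=
          Finset.sdiff_nonempty.2 fun h => ht (Finset.univ_subset_iff.1 h)
        rw [Finset.prod_eq_zero hj neg_zero, mul_zero]
    simp_rw [hexpand]
    exact hlimit ▸ tendsto_finsetSum _ fun t _ =>
      (hprod t).mul (tendsto_finsetProd _ fun j _ => (hmean j).neg)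

section Measurability

variable {Ω : Type*} [MeasurableSpace Ω] {P : Measure Ω} [MeasurableSpace E]
  [MeasurableConstSMul ℝ E] {n : ℕ} {v : ℕ → Ω → E}

theorem aemeasurable_avg [MeasurableAdd₂ E] (hv : ∀ i, AEMeasurable (v i) P) :
    AEMeasurable (fun ω => avg n fun i => v i ω) P :=
  (Finset.aemeasurable_fun_sum _ fun i _ => hv i).const_smul (n : ℝ)⁻¹

theorem aemeasurable_obs [MeasurableAdd₂ E] [MeasurableSub₂ E] (c : Centering)
    (hv : ∀ i, AEMeasurable (v i) P) (i : ℕ) :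
    AEMeasurable (fun ω => c.obs n (fun i => v i ω) i) P := by
  cases c with
  | population => exact hv i
  | sampleMean => exact (hv i).sub (aemeasurable_avg hv)

end Measurability

end Averages

section CenteredLp

variable {S : Type*} [MeasurableSpace S] {μ : Measure S}

/-- Mean zero random variables with finite moment of order `p`. The integrability that makes the
mean meaningful follows from `1 ≤ p` over a finite measure. -/
structure CenteredLp (p : ENNReal) (μ : Measure S) (f : S → ℝ) : Prop where
  memLp : MemLp f p μ
  integral_eq_zero : ∫ s, f s ∂μ = 0

theorem CenteredLp.mono [IsFiniteMeasure μ] {p q : ENNReal} {f : S → ℝ} (hf : CenteredLp q μ f)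
    (hpq : p ≤ q) : CenteredLp p μ f :=
  ⟨hf.memLp.mono_exponent hpq, hf.integral_eq_zero⟩

theorem memLp_dotProduct {d : ℕ} {p : ENNReal} {X : S → Fin d → ℝ}
    (hX : ∀ b, MemLp (fun s => X s b) p μ) (β : Fin d → ℝ) :
    MemLp (fun s => X s ⬝ᵥ β) p μ := by
  simp only [dotProduct]
  exact memLp_finsetSum _ fun b _ => (hX b).mul_const _

theorem integral_mul_dotProduct {d : ℕ} {u : S → ℝ} {X : S → Fin d → ℝ}
    (h : ∀ b, Integrable (fun s => u s * X s b) μ) (β : Fin d → ℝ) :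
    ∫ s, u s * (X s ⬝ᵥ β) ∂μ = (fun b => ∫ s, u s * X s b ∂μ) ⬝ᵥ β := by
  simp only [dotProduct, Finset.mul_sum, ← mul_assoc]
  rw [integral_finsetSum _ fun b _ => (h b).mul_const _]
  simp only [integral_mul_const]

theorem centeredLp_dotProduct [IsFiniteMeasure μ] {d : ℕ} {p : ENNReal} (hp : 1 ≤ p)
    {X : S → Fin d → ℝ} (hX : ∀ b, CenteredLp p μ fun s => X s b) (β : Fin d → ℝ) :
    CenteredLp p μ fun s => X s ⬝ᵥ β where
  memLp := memLp_dotProduct (fun b => (hX b).memLp) β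
  integral_eq_zero := by
    have h := integral_mul_dotProduct (u := fun _ => 1) (X := X)
      (fun b => by simpa only [one_mul] using (hX b).memLp.integrable hp) β
    simpa [(hX _).integral_eq_zero] using h

theorem memLp_two_mul {f g : S → ℝ} (hf : MemLp f 4 μ) (hg : MemLp g 4 μ) :
    MemLp (fun s => f s * g s) 2 μ := by
  have : ENNReal.HolderTriple 4 4 2 := ⟨by
    rw [← two_mul, show (4 : ENNReal) = 2 * 2 by norm_num,
      ENNReal.mul_inv (by simp) (by simp), ENNReal.mul_inv_cancel_left (by simp) (by simp)]⟩
  exact hg.mul hf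

theorem integrable_prod_of_memLp_card [IsFiniteMeasure μ] {ι : Type*} [Fintype ι] {f : ι → S → ℝ}
    (hf : ∀ j, MemLp (f j) (Fintype.card ι) μ) (t : Finset ι) :
    Integrable (fun s => ∏ j ∈ t, f j s) μ := by
  refine (MemLp.prod' (s := t) fun j _ => hf j).integrable ?_
  rw [Finset.sum_const, nsmul_eq_mul, ENNReal.one_le_inv, ← div_eq_mul_inv]
  exact ENNReal.div_le_of_le_mul (by simpa using Finset.card_le_univ t)

end CenteredLp

section LawOfLargeNumbers

variable {Ω S E : Type*} [MeasurableSpace Ω] [MeasurableSpace S] {P : Measure Ω} {μ : Measure S}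

/-- The variables `ξ i` are independent copies of `ξ₀`, which may live on another space. -/
structure IIDSample [MeasurableSpace E] (P : Measure Ω) (μ : Measure S) (ξ : ℕ → Ω → E)
    (ξ₀ : S → E) : Prop where
  identDistrib : ∀ i, IdentDistrib (ξ i) ξ₀ P μ
  indep : iIndepFun ξ P

theorem IIDSample.comp {F : Type*} [MeasurableSpace E] [MeasurableSpace F] {ξ : ℕ → Ω → E}
    {ξ₀ : S → E} (h : IIDSample P μ ξ ξ₀) {f : E → F} (hf : Measurable f) :
    IIDSample P μ (fun i ω => f (ξ i ω)) fun s => f (ξ₀ s) :=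
  ⟨fun i => (h.identDistrib i).comp hf, h.indep.comp (fun _ => f) fun _ => hf⟩

theorem IIDSample.aemeasurable [MeasurableSpace E] {ξ : ℕ → Ω → E} {ξ₀ : S → E}
    (h : IIDSample P μ ξ ξ₀) (i : ℕ) : AEMeasurable (ξ i) P :=
  (h.identDistrib i).aemeasurable_fst

theorem IIDSample.aemeasurable_obs_fst {F : Type*} [AddCommGroup E] [Module ℝ E]
    [MeasurableSpace E] [MeasurableConstSMul ℝ E] [MeasurableAdd₂ E] [MeasurableSub₂ E]
    [MeasurableSpace F] {ξ : ℕ → Ω → E} {η : ℕ → Ω → F} {ζ₀ : S → E × F}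
    (h : IIDSample P μ (fun i ω => (ξ i ω, η i ω)) ζ₀) (c : Centering) (n i : ℕ) :
    AEMeasurable (fun ω => c.obs n (fun i => ξ i ω) i) P :=
  aemeasurable_obs c (fun i => (h.aemeasurable i).fst) i

theorem IIDSample.aemeasurable_obs_snd {F : Type*} [AddCommGroup E] [Module ℝ E]
    [MeasurableSpace E] [MeasurableConstSMul ℝ E] [MeasurableAdd₂ E] [MeasurableSub₂ E]
    [MeasurableSpace F] {ξ : ℕ → Ω → F} {η : ℕ → Ω → E} {ζ₀ : S → F × E}
    (h : IIDSample P μ (fun i ω => (ξ i ω, η i ω)) ζ₀) (c : Centering) (n i : ℕ) :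
    AEMeasurable (fun ω => c.obs n (fun i => η i ω) i) P :=
  aemeasurable_obs c (fun i => (h.aemeasurable i).snd) i

theorem ae_tendsto_avg [NormedAddCommGroup E] [NormedSpace ℝ E] [CompleteSpace E]
    [MeasurableSpace E] [BorelSpace E] {ξ : ℕ → Ω → E} {ξ₀ : S → E} (h : IIDSample P μ ξ ξ₀)
    (hint : Integrable ξ₀ μ) :
    ∀ᵐ ω ∂P, Tendsto (fun n => avg n fun i => ξ i ω) atTop (𝓝 (∫ s, ξ₀ s ∂μ)) := by
  rw [← (h.identDistrib 0).integral_eq]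
  exact strong_law_ae ξ ((h.identDistrib 0).integrable_iff.2 hint)
    (fun i j hij => h.indep.indepFun hij)
    fun i => (h.identDistrib i).trans (h.identDistrib 0).symm

theorem tendsto_inProb_avg [IsFiniteMeasure P] {ξ : ℕ → Ω → ℝ} {ξ₀ : S → ℝ}
    (h : IIDSample P μ ξ ξ₀) (hint : Integrable ξ₀ μ) {n : ℕ → ℕ} (hn : Tendsto n atTop atTop) :
    Tendsto (fun p : ℕ × Ω => avg (n p.1) fun i => ξ i p.2) (inProb atTop P)
      (𝓝 (∫ s, ξ₀ s ∂μ)) := by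
  refine tendsto_inProb_of_ae (f := fun k ω => avg (n k) fun i => ξ i ω)
    (fun k => (aemeasurable_avg h.aemeasurable).aestronglyMeasurable) ?_
  filter_upwards [ae_tendsto_avg h hint] with ω hω using hω.comp hn

variable [MeasurableSpace E] {ξ : ℕ → Ω → E} {ξ₀ : S → E} {n : ℕ → ℕ} [IsFiniteMeasure P]
  [IsFiniteMeasure μ]

theorem tendsto_inProb_avg_prod_obs {ι : Type*} [Fintype ι] (c : Centering)
    (h : IIDSample P μ ξ ξ₀) {f : ι → E → ℝ} (hf : ∀ j, Measurable (f j))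
    (hf₀ : ∀ j, CenteredLp (Fintype.card ι) μ fun s => f j (ξ₀ s)) (hn : Tendsto n atTop atTop) :
    Tendsto (fun p : ℕ × Ω => avg (n p.1) fun i =>
        ∏ j, c.obs (n p.1) (fun i => f j (ξ i p.2)) i) (inProb atTop P)
      (𝓝 (∫ s, ∏ j, f j (ξ₀ s) ∂μ)) := by
  have hint (t : Finset ι) := integrable_prod_of_memLp_card (fun j => (hf₀ j).memLp) t
  have hprod (t : Finset ι) : Tendsto (fun p : ℕ × Ω => avg (n p.1) fun i => ∏ j ∈ t, f j (ξ i p.2))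
      (inProb atTop P) (𝓝 (∫ s, ∏ j ∈ t, f j (ξ₀ s) ∂μ)) :=
    tendsto_inProb_avg (h.comp (f := fun x => ∏ j ∈ t, f j x)
      (Finset.measurable_fun_prod t fun j _ => hf j)) (hint t) hn
  have hmean (j : ι) : Tendsto (fun p : ℕ × Ω => avg (n p.1) fun i => f j (ξ i p.2))
      (inProb atTop P) (𝓝 0) := by
    simpa only [Finset.prod_singleton, (hf₀ j).integral_eq_zero] using hprod {j}
  exact tendsto_avg_prod_obs (l := inProb atTop P) c (n := fun p : ℕ × Ω => n p.1)
    (u := fun p j i => f j (ξ i p.2)) (L := fun t => ∫ s, ∏ j ∈ t, f j (ξ₀ s) ∂μ) hprod hmean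

theorem tendsto_inProb_avg_obs_mul_obs (c : Centering) (h : IIDSample P μ ξ ξ₀) {f g : E → ℝ}
    (hf : Measurable f) (hg : Measurable g) (hf₀ : CenteredLp 2 μ fun s => f (ξ₀ s))
    (hg₀ : CenteredLp 2 μ fun s => g (ξ₀ s)) (hn : Tendsto n atTop atTop) :
    Tendsto (fun p : ℕ × Ω => avg (n p.1) fun i =>
        c.obs (n p.1) (fun i => f (ξ i p.2)) i * c.obs (n p.1) (fun i => g (ξ i p.2)) i)
      (inProb atTop P) (𝓝 (∫ s, f (ξ₀ s) * g (ξ₀ s) ∂μ)) := by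
  simpa [Fin.prod_univ_two] using tendsto_inProb_avg_prod_obs c h (f := ![f, g])
    (by simp [Fin.forall_fin_succ, hf, hg]) (by simp [Fin.forall_fin_succ, hf₀, hg₀]) hn

theorem tendsto_inProb_avg_obs_mul_obs_mul_obs_mul_obs (c : Centering) (h : IIDSample P μ ξ ξ₀)
    {f₁ f₂ f₃ f₄ : E → ℝ} (hf₁ : Measurable f₁) (hf₂ : Measurable f₂) (hf₃ : Measurable f₃)
    (hf₄ : Measurable f₄) (h₁ : CenteredLp 4 μ fun s => f₁ (ξ₀ s))
    (h₂ : CenteredLp 4 μ fun s => f₂ (ξ₀ s)) (h₃ : CenteredLp 4 μ fun s => f₃ (ξ₀ s))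
    (h₄ : CenteredLp 4 μ fun s => f₄ (ξ₀ s)) (hn : Tendsto n atTop atTop) :
    Tendsto (fun p : ℕ × Ω => avg (n p.1) fun i =>
        c.obs (n p.1) (fun i => f₁ (ξ i p.2)) i * c.obs (n p.1) (fun i => f₂ (ξ i p.2)) i *
          c.obs (n p.1) (fun i => f₃ (ξ i p.2)) i * c.obs (n p.1) (fun i => f₄ (ξ i p.2)) i)
      (inProb atTop P) (𝓝 (∫ s, f₁ (ξ₀ s) * f₂ (ξ₀ s) * f₃ (ξ₀ s) * f₄ (ξ₀ s) ∂μ)) := by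
  simpa [Fin.prod_univ_four] using tendsto_inProb_avg_prod_obs c h (f := ![f₁, f₂, f₃, f₄])
    (by simp [Fin.forall_fin_succ, hf₁, hf₂, hf₃, hf₄])
    (by simp [Fin.forall_fin_succ, h₁, h₂, h₃, h₄]) hn

end LawOfLargeNumbers

section CovarianceMatrix

variable {S : Type*} [MeasurableSpace S] {μ : Measure S} [IsFiniteMeasure μ] {m : ℕ}

theorem dotProduct_varMatrix_mulVec {A : S → Fin m → ℝ} (hA : ∀ a, MemLp (fun s => A s a) 2 μ)
    (t : Fin m → ℝ) : t ⬝ᵥ varMatrix μ A *ᵥ t = Var[fun s => A s ⬝ᵥ t; μ] := by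
  have hterm (a : Fin m) : MemLp (fun s => A s a * t a) 2 μ := (hA a).mul_const _
  rw [← covariance_self (memLp_dotProduct hA t).aestronglyMeasurable.aemeasurable]
  simp only [dotProduct]
  rw [covariance_fun_sum_fun_sum hterm hterm]
  simp only [covariance_mul_const_left, covariance_mul_const_right, mulVec, dotProduct,
    Finset.mul_sum, varMatrix, crossCov, Matrix.of_apply]
  exact Finset.sum_congr rfl fun a _ => Finset.sum_congr rfl fun b _ => by ring

theorem posSemidef_varMatrix {A : S → Fin m → ℝ} (hA : ∀ a, MemLp (fun s => A s a) 2 μ) :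
    (varMatrix μ A).PosSemidef := by
  refine posSemidef_iff_dotProduct_mulVec.2 ⟨?_, fun t => ?_⟩
  · ext a b
    simp [varMatrix, crossCov, covariance_comm]
  · rw [star_trivial, dotProduct_varMatrix_mulVec hA]
    exact variance_nonneg _ _

end CovarianceMatrix

section Gaussian

variable {ι κ : Type*} [Fintype ι] [DecidableEq ι] [Fintype κ] [DecidableEq κ]
  {A : Matrix ι ι ℝ}

theorem multivariateGaussian_conv {B : Matrix ι ι ℝ} (hA : A.PosSemidef) (hB : B.PosSemidef)
    (a b : EuclideanSpace ℝ ι) :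
    multivariateGaussian a A ∗ multivariateGaussian b B = multivariateGaussian (a + b) (A + B) := by
  refine Measure.ext_of_charFun (funext fun t => ?_)
  rw [charFun_conv, charFun_multivariateGaussian hA, charFun_multivariateGaussian hB,
    charFun_multivariateGaussian (hA.add hB), ← Complex.exp_add]
  congr 1
  simp only [inner_add_right, add_mulVec, dotProduct_add, Complex.ofReal_add]
  ring

theorem multivariateGaussian_map_mulVec (hA : A.PosSemidef) (a : EuclideanSpace ℝ ι)
    (M : Matrix κ ι ℝ) :
    (multivariateGaussian a A).map (fun x => WithLp.toLp 2 (M *ᵥ x.ofLp)) =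
      multivariateGaussian (WithLp.toLp 2 (M *ᵥ a.ofLp)) (M * A * Mᵀ) := by
  have hM : Continuous fun x : EuclideanSpace ℝ ι => WithLp.toLp 2 (M *ᵥ x.ofLp) :=
    (PiLp.continuous_toLp 2 _).comp (continuous_const.matrix_mulVec (PiLp.continuous_ofLp 2 _))
  have := Measure.isProbabilityMeasure_map (μ := multivariateGaussian a A) hM.aemeasurable
  have hadjoint (t : EuclideanSpace ℝ κ) (x : EuclideanSpace ℝ ι) :
      inner ℝ (WithLp.toLp 2 (M *ᵥ x.ofLp)) t = inner ℝ x (WithLp.toLp 2 (Mᵀ *ᵥ t.ofLp)) := by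
    simp only [EuclideanSpace.inner_eq_star_dotProduct, star_trivial]
    rw [dotProduct_mulVec, mulVec_transpose]
  refine Measure.ext_of_charFun (funext fun t => ?_)
  have hchar : charFun ((multivariateGaussian a A).map fun x => WithLp.toLp 2 (M *ᵥ x.ofLp)) t =
      charFun (multivariateGaussian a A) (WithLp.toLp 2 (Mᵀ *ᵥ t.ofLp)) := by
    rw [charFun_apply, charFun_apply, integral_map hM.aemeasurable (by fun_prop)]
    simp only [hadjoint]
  have hform : t.ofLp ⬝ᵥ (M * A * Mᵀ) *ᵥ t.ofLp = (Mᵀ *ᵥ t.ofLp) ⬝ᵥ A *ᵥ Mᵀ *ᵥ t.ofLp := by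
    rw [mulVec_transpose, ← dotProduct_mulVec, mulVec_mulVec, ← mulVec_transpose, mulVec_mulVec,
      Matrix.mul_assoc]
  rw [charFun_multivariateGaussian (by simpa using hA.mul_mul_conjTranspose_same M), hchar,
    charFun_multivariateGaussian hA, hform,
    real_inner_comm (WithLp.toLp 2 (M *ᵥ a.ofLp)) t, hadjoint, real_inner_comm]

end Gaussian

section ConvergenceInDistribution

theorem charFun_map_eq_charFun_map_inner {Ω E : Type*} [MeasurableSpace Ω] {P : Measure Ω}
    [NormedAddCommGroup E] [InnerProductSpace ℝ E]
    [MeasurableSpace E] [BorelSpace E] [SecondCountableTopology E] {X : Ω → E}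
    (hX : AEMeasurable X P) (t : E) :
    charFun (P.map X) t = charFun (P.map fun ω => inner ℝ (X ω) t) 1 := by
  have hinner : AEMeasurable (fun ω => inner ℝ (X ω) t) P := hX.inner aemeasurable_const
  rw [charFun_apply, charFun_apply, integral_map hX (by fun_prop),
    integral_map hinner (by fun_prop)]
  simp

variable {Ω : Type*} [MeasurableSpace Ω] {P : Measure Ω} [IsProbabilityMeasure P]
  {ι κ : Type*} [Fintype ι] [DecidableEq ι] {A : Matrix ι ι ℝ}

theorem tendstoInDistribution_mulVec [Fintype κ] [DecidableEq κ] {α : Type*} {l : Filter α}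
    [l.IsCountablyGenerated] {a : EuclideanSpace ℝ ι} (hA : A.PosSemidef)
    {G : α → Ω → EuclideanSpace ℝ ι} {M : α → Ω → Matrix κ ι ℝ} {M₀ : Matrix κ ι ℝ}
    (hG : TendstoInDistribution G l id (fun _ => P) (multivariateGaussian a A))
    (hM : Tendsto (fun p : α × Ω => M p.1 p.2) (inProb l P) (𝓝 M₀))
    (hMm : ∀ k, AEMeasurable (M k) P) :
    TendstoInDistribution (fun k ω => WithLp.toLp 2 (M k ω *ᵥ (G k ω).ofLp)) l id (fun _ => P)
      (multivariateGaussian (WithLp.toLp 2 (M₀ *ᵥ a.ofLp)) (M₀ * A * M₀ᵀ)) := by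
  have hcont : Continuous fun q : EuclideanSpace ℝ ι × (κ → ι → ℝ) =>
      (WithLp.toLp 2 (Matrix.of q.2 *ᵥ q.1.ofLp) : EuclideanSpace ℝ κ) :=
    (PiLp.continuous_toLp 2 _).comp
      (Continuous.matrix_mulVec continuous_snd ((PiLp.continuous_ofLp 2 _).comp continuous_fst))
  have hMG := hG.continuous_comp_prodMk_of_tendstoInMeasure_const hcont
    (Y := fun k ω => (M k ω : κ → ι → ℝ)) (c := M₀) (tendstoInMeasure_const_iff.2 hM) hMm
  refine tendstoInDistribution_congr_limit hMG aemeasurable_id ?_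
  rw [Measure.map_id]
  exact multivariateGaussian_map_mulVec hA a M₀

theorem tendstoInDistribution_multivariateGaussian_of_forall_inner (hA : A.PosSemidef)
    {a : EuclideanSpace ℝ ι} {G : ℕ → Ω → EuclideanSpace ℝ ι} (hG : ∀ k, AEMeasurable (G k) P)
    (h : ∀ t, TendstoInDistribution (fun k ω => inner ℝ (G k ω) t) atTop id (fun _ => P)
      (gaussianReal (inner ℝ a t) (t.ofLp ⬝ᵥ A *ᵥ t.ofLp).toNNReal)) :
    TendstoInDistribution G atTop id (fun _ => P) (multivariateGaussian a A) := by
  refine ⟨hG, aemeasurable_id, ProbabilityMeasure.tendsto_iff_tendsto_charFun.2 fun t => ?_⟩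
  have hchar := ProbabilityMeasure.tendsto_iff_tendsto_charFun.1 (h t).tendsto 1
  have hnonneg : 0 ≤ t.ofLp ⬝ᵥ A *ᵥ t.ofLp := by
    simpa using hA.dotProduct_mulVec_nonneg t.ofLp
  simp only [ProbabilityMeasure.coe_mk, Measure.map_id, charFun_gaussianReal] at hchar
  simp only [ProbabilityMeasure.coe_mk, Measure.map_id, charFun_multivariateGaussian hA,
    charFun_map_eq_charFun_map_inner (hG _)]
  convert! hchar using 2
  simp [Real.coe_toNNReal _ hnonneg, real_inner_comm]

theorem tendstoInDistribution_add_of_indepFun {E : Type*} [NormedAddCommGroup E]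
    [InnerProductSpace ℝ E] [FiniteDimensional ℝ E] [MeasurableSpace E] [BorelSpace E]
    {X Y : ℕ → Ω → E} {ν ρ : Measure E} [IsProbabilityMeasure ν] [IsProbabilityMeasure ρ]
    (hX : TendstoInDistribution X atTop id (fun _ => P) ν)
    (hY : TendstoInDistribution Y atTop id (fun _ => P) ρ) (hXY : ∀ k, IndepFun (X k) (Y k) P) :
    TendstoInDistribution (fun k ω => X k ω + Y k ω) atTop id (fun _ => P) (ν ∗ ρ) := by
  have hXm := hX.forall_aemeasurable
  have hYm := hY.forall_aemeasurable
  refine ⟨fun k => (hXm k).add (hYm k), aemeasurable_id,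
    ProbabilityMeasure.tendsto_iff_tendsto_charFun.2 fun t => ?_⟩
  have hprod := (ProbabilityMeasure.tendsto_iff_tendsto_charFun.1 hX.tendsto t).mul
    (ProbabilityMeasure.tendsto_iff_tendsto_charFun.1 hY.tendsto t)
  simp only [ProbabilityMeasure.coe_mk, Measure.map_id] at hprod ⊢
  rw [charFun_conv]
  refine hprod.congr fun k => ?_
  rw [(hXY k).charFun_map_fun_add_eq_mul (hXm k) (hYm k), Pi.mul_apply]

end ConvergenceInDistribution

section CentralLimit

variable {Ω S : Type*} [MeasurableSpace Ω] [MeasurableSpace S] {P : Measure Ω}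
  [IsProbabilityMeasure P] {μ : Measure S} {n : ℕ → ℕ} {r : ℕ → ℝ} {v : ℝ}

theorem tendstoInDistribution_mul_avg_sub_integral {ξ : ℕ → Ω → ℝ} {ξ₀ : S → ℝ}
    (h : IIDSample P μ ξ ξ₀) (hξ₀ : MemLp ξ₀ 2 μ) (hn : Tendsto n atTop atTop)
    (hr : Tendsto (fun k => r k / √(n k)) atTop (𝓝 v)) :
    TendstoInDistribution
      (fun k ω => r k * (avg (n k) (fun i => ξ i ω) - ∫ s, ξ₀ s ∂μ)) atTop id (fun _ => P)
      (gaussianReal 0 (v ^ 2 * Var[ξ₀; μ]).toNNReal) := by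
  have hclt := tendstoInDistribution_inv_sqrt_mul_sum_sub (X := ξ)
    (P' := gaussianReal 0 Var[ξ₀; μ].toNNReal) (Y := id) (P := P)
    (by rw [(h.identDistrib 0).variance_eq]; exact HasLaw.id)
    ((h.identDistrib 0).memLp_iff.2 hξ₀) h.indep
    (fun i => (h.identDistrib i).trans (h.identDistrib 0).symm)
  rw [(h.identDistrib 0).integral_eq] at hclt
  have hsubseq : TendstoInDistribution (fun k ω => (√(n k : ℝ))⁻¹ *
      (∑ i ∈ Finset.range (n k), ξ i ω - n k * ∫ s, ξ₀ s ∂μ)) atTop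
      (id : ℝ → ℝ) (fun _ => P) (gaussianReal 0 Var[ξ₀; μ].toNNReal) :=
    ⟨fun k => hclt.forall_aemeasurable (n k), hclt.aemeasurable_limit, hclt.tendsto.comp hn⟩
  have hscaled := hsubseq.continuous_comp_prodMk_of_tendstoInMeasure_const
    (g := fun q : ℝ × ℝ => q.2 * q.1) (by fun_prop) (Y := fun k _ => r k / √(n k)) (c := v)
    (tendstoInMeasure_const_iff.2 (hr.comp tendsto_fst_inProb)) (fun k => aemeasurable_const)
  refine tendstoInDistribution_congr_limit (tendstoInDistribution_of_eventually_eq hscaled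
    (fun k => ((aemeasurable_avg h.aemeasurable).sub_const _).const_mul _) ?_) aemeasurable_id ?_
  · filter_upwards [tendsto_fst_inProb.eventually (hn.eventually_gt_atTop 0)] with p hp
    have hpos : (0 : ℝ) < n p.1 := by exact_mod_cast hp
    have hsqrt : √(n p.1 : ℝ) ≠ 0 := (Real.sqrt_pos.2 hpos).ne'
    simp only [avg, smul_eq_mul]
    field_simp
    rw [Real.sq_sqrt hpos.le]
    field_simp
  · rw [Measure.map_id]
    simp only [id_eq]
    rw [gaussianReal_map_const_mul, mul_zero, Real.toNNReal_mul (sq_nonneg v)]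
    congr 2
    ext
    simp [sq_nonneg]

variable [IsFiniteMeasure μ] {m : ℕ}

theorem tendstoInDistribution_smul_avg_sub_integral {ξ : ℕ → Ω → Fin m → ℝ} {ξ₀ : S → Fin m → ℝ}
    (h : IIDSample P μ ξ ξ₀) (hξ₀ : ∀ a, MemLp (fun s => ξ₀ s a) 2 μ) (hn : Tendsto n atTop atTop)
    (hr : Tendsto (fun k => r k / √(n k)) atTop (𝓝 v)) :
    TendstoInDistribution (fun k ω => r k • WithLp.toLp 2
        (avg (n k) (fun i => ξ i ω) - fun a => ∫ s, ξ₀ s a ∂μ)) atTop id (fun _ => P)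
      (multivariateGaussian 0 (v ^ 2 • varMatrix μ ξ₀)) := by
  have hG (k : ℕ) : AEMeasurable (fun ω => r k • WithLp.toLp 2
      (avg (n k) (fun i => ξ i ω) - fun a => ∫ s, ξ₀ s a ∂μ)) P :=
    ((WithLp.measurable_toLp 2 _).comp_aemeasurable
      ((aemeasurable_avg h.aemeasurable).sub_const _)).const_smul (r k)
  refine tendstoInDistribution_multivariateGaussian_of_forall_inner
    ((posSemidef_varMatrix hξ₀).smul (sq_nonneg v)) hG fun t => ?_
  have hdot := tendstoInDistribution_mul_avg_sub_integral
    (h.comp (f := fun x => x ⬝ᵥ t.ofLp) (by simp only [dotProduct]; fun_prop))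
    (memLp_dotProduct hξ₀ t.ofLp) hn hr
  have hmean : ∫ s, ξ₀ s ⬝ᵥ t.ofLp ∂μ = (fun a => ∫ s, ξ₀ s a ∂μ) ⬝ᵥ t.ofLp := by
    simpa only [one_mul] using integral_mul_dotProduct (u := fun _ => 1) (X := ξ₀)
      (fun a => by simpa only [one_mul] using (hξ₀ a).integrable (by norm_num)) t.ofLp
  have hlinear (k : ℕ) (ω : Ω) : inner ℝ (r k • WithLp.toLp 2
        (avg (n k) (fun i => ξ i ω) - fun a => ∫ s, ξ₀ s a ∂μ)) t =
      r k * (avg (n k) (fun i => ξ i ω ⬝ᵥ t.ofLp) - ∫ s, ξ₀ s ⬝ᵥ t.ofLp ∂μ) := by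
    rw [real_inner_smul_left, real_inner_comm, EuclideanSpace.inner_eq_star_dotProduct,
      star_trivial, sub_dotProduct, hmean]
    congr 2
    exact map_avg ((dotProductBilin ℝ ℝ).flip t.ofLp) _ _
  simpa only [hlinear, inner_zero_left, smul_mulVec, dotProduct_smul, smul_eq_mul,
    dotProduct_varMatrix_mulVec hξ₀] using hdot

theorem tendstoInDistribution_smul_avg_sub_avg {ξ η : ℕ → Ω → Fin m → ℝ} {ξ₀ η₀ : S → Fin m → ℝ}
    (h : IIDSample P μ ξ ξ₀) (h' : IIDSample P μ η η₀)
    (hindep : IndepFun (fun ω i => ξ i ω) (fun ω j => η j ω) P)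
    (hξ₀ : ∀ a, MemLp (fun s => ξ₀ s a) 2 μ) (hη₀ : ∀ a, MemLp (fun s => η₀ s a) 2 μ)
    (hmean : ∀ a, ∫ s, ξ₀ s a ∂μ = ∫ s, η₀ s a ∂μ) (hn : Tendsto n atTop atTop) {n' : ℕ → ℕ}
    (hn' : Tendsto n' atTop atTop) {v' : ℝ} (hr : Tendsto (fun k => r k / √(n k)) atTop (𝓝 v))
    (hr' : Tendsto (fun k => r k / √(n' k)) atTop (𝓝 v')) :
    TendstoInDistribution (fun k ω => r k • WithLp.toLp 2
        (avg (n k) (fun i => ξ i ω) - avg (n' k) (fun j => η j ω))) atTop id (fun _ => P)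
      (multivariateGaussian 0 (v ^ 2 • varMatrix μ ξ₀ + v' ^ 2 • varMatrix μ η₀)) := by
  have hmeasurable (N : ℕ) (q : ℝ) (c : Fin m → ℝ) : Measurable fun x : ℕ → Fin m → ℝ =>
      q • WithLp.toLp 2 (avg N x - c) := by
    simp only [avg]
    fun_prop
  have hsum := tendstoInDistribution_add_of_indepFun
    (tendstoInDistribution_smul_avg_sub_integral h hξ₀ hn hr)
    (tendstoInDistribution_smul_avg_sub_integral h' hη₀ hn' (r := fun k => -r k)
      (by simpa only [neg_div] using hr'.neg))
    fun k => hindep.comp (hmeasurable (n k) (r k) _) (hmeasurable (n' k) (-r k) _)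
  simp only [multivariateGaussian_conv ((posSemidef_varMatrix hξ₀).smul (sq_nonneg v))
    ((posSemidef_varMatrix hη₀).smul (sq_nonneg _)), neg_sq, add_zero] at hsum
  refine hsum.congr (fun k => .of_forall fun ω => ?_) (by rfl)
  simp only [hmean, neg_smul, ← sub_eq_add_neg, ← smul_sub, ← WithLp.toLp_sub,
    sub_sub_sub_cancel_right]

end CentralLimit

section ProductOfMeans

variable {Ω S : Type*} [MeasurableSpace Ω] [MeasurableSpace S] {P : Measure Ω}
  [IsProbabilityMeasure P] {μ : Measure S}

theorem tendsto_inProb_mul_avg_mul_avg {ξ η : ℕ → Ω → ℝ} {ξ₀ η₀ : S → ℝ}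
    (h : IIDSample P μ ξ ξ₀) (h' : IIDSample P μ η η₀) (hξ₀ : CenteredLp 2 μ ξ₀)
    (hη₀ : CenteredLp 1 μ η₀) {n n' : ℕ → ℕ} (hn : Tendsto n atTop atTop)
    (hn' : Tendsto n' atTop atTop) {r : ℕ → ℝ} {v : ℝ}
    (hr : Tendsto (fun k => r k / √(n k)) atTop (𝓝 v)) :
    Tendsto (fun p : ℕ × Ω => r p.1 * ((avg (n p.1) fun i => ξ i p.2) *
      avg (n' p.1) fun i => η i p.2)) (inProb atTop P) (𝓝 0) := by
  have hη : TendstoInMeasure P (fun k ω => avg (n' k) fun i => η i ω) atTop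
      fun _ => ∫ s, η₀ s ∂μ :=
    tendstoInMeasure_const_iff.2 (tendsto_inProb_avg h' (memLp_one_iff_integrable.1 hη₀.memLp) hn')
  have hprod := (tendstoInDistribution_mul_avg_sub_integral h hξ₀.memLp hn hr)
    |>.continuous_comp_prodMk_of_tendstoInMeasure_const
    (g := fun q : ℝ × ℝ => q.1 * q.2) (by fun_prop) (Y := fun k ω => avg (n' k) fun i => η i ω)
    (c := ∫ s, η₀ s ∂μ) hη (fun k => aemeasurable_avg h'.aemeasurable)
  simp only [hξ₀.integral_eq_zero, hη₀.integral_eq_zero, mul_zero, sub_zero, mul_assoc] at hprod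
  exact (tendsto_inProb_of_tendstoInDistribution_const hprod :)

end ProductOfMeans

section SampleMoments

variable {m d : ℕ}

theorem obs_dotProduct (c : Centering) (n : ℕ) (X : ℕ → Fin d → ℝ) (β : Fin d → ℝ) (j : ℕ) :
    c.obs n X j ⬝ᵥ β = c.obs n (fun j => X j ⬝ᵥ β) j :=
  map_obs ((dotProductBilin ℝ ℝ).flip β) c n X j

theorem momentIX_apply (n : ℕ) (I : ℕ → Fin m → ℝ) (X : ℕ → Fin d → ℝ) (a : Fin m) (b : Fin d) :
    momentIX n I X a b = avg n fun j => I j a * X j b :=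
  map_avg (Matrix.entryLinearMap ℝ ℝ a b) n _

theorem momentIX_mulVec (n : ℕ) (I : ℕ → Fin m → ℝ) (X : ℕ → Fin d → ℝ) (β : Fin d → ℝ) :
    momentIX n I X *ᵥ β = momentIY n I fun j => X j ⬝ᵥ β :=
  (map_avg ((mulVecBilin ℝ ℝ).flip β) n _).trans <| congrArg (avg n) <| funext fun j =>
    (vecMulVec_mulVec (I j) (X j) β).trans (op_smul_eq_smul _ _)

theorem momentIY_obs_sampleMean (n : ℕ) (I : ℕ → Fin m → ℝ) (Y : ℕ → ℝ) :
    momentIY n (Centering.sampleMean.obs n I) (Centering.sampleMean.obs n Y) =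
      momentIY n I Y - avg n Y • avg n I :=
  avg_bilin_sub_avg (LinearMap.lsmul ℝ (Fin m → ℝ)) n Y I

theorem empVar_apply (n : ℕ) (v : ℕ → Fin m → ℝ) (a b : Fin m) :
    empVar n v a b = (avg n fun i => v i a * v i b) -
      (avg n fun i => v i a) * avg n fun i => v i b := by
  rw [← avg_apply, ← avg_apply, ← vecMulVec_apply, ← momentIX_apply, ← Matrix.sub_apply]
  exact congrFun₂ (avg_bilin_sub_avg (vecMulVecBilin ℝ ℝ) n v v) a b

theorem posSemidef_empVar (n : ℕ) (v : ℕ → Fin m → ℝ) : (empVar n v).PosSemidef :=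
  (posSemidef_sum _ fun i _ => by
    simpa only [star_trivial] using posSemidef_vecMulVec_self_star (v i - avg n v)).smul
      (inv_nonneg.2 n.cast_nonneg)

theorem posSemidef_momentVarHat (n n' : ℕ) (I : ℕ → Fin m → ℝ) (Y : ℕ → ℝ)
    (I' : ℕ → Fin m → ℝ) (X' : ℕ → Fin d → ℝ) (β : EuclideanSpace ℝ (Fin d)) :
    (momentVarHat n n' I Y I' X' β).PosSemidef :=
  ((posSemidef_empVar _ _).smul (by positivity)).add ((posSemidef_empVar _ _).smul (by positivity))

section Measurability

variable {Ω : Type*} [MeasurableSpace Ω] {P : Measure Ω} {n n' : ℕ} {I I' : ℕ → Ω → Fin m → ℝ}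
  {X : ℕ → Ω → Fin d → ℝ}

theorem aemeasurable_dotProduct {u v : Ω → Fin d → ℝ} (hu : AEMeasurable u P)
    (hv : AEMeasurable v P) : AEMeasurable (fun ω => u ω ⬝ᵥ v ω) P :=
  (continuous_fst.dotProduct continuous_snd).measurable.comp_aemeasurable (hu.prodMk hv)

theorem aemeasurable_momentIX (hI : ∀ i, AEMeasurable (I i) P) (hX : ∀ i, AEMeasurable (X i) P) :
    AEMeasurable (fun ω => momentIX n (fun i => I i ω) (fun i => X i ω)) P :=
  aemeasurable_avg fun i =>
    (continuous_fst.matrix_vecMulVec continuous_snd).measurable.comp_aemeasurable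
      ((hI i).prodMk (hX i))

theorem aemeasurable_empVar (hI : ∀ i, AEMeasurable (I i) P) :
    AEMeasurable (fun ω => empVar n fun i => I i ω) P :=
  have hcentered (i : ℕ) := (hI i).sub (aemeasurable_avg (n := n) hI)
  aemeasurable_momentIX hcentered hcentered

theorem aemeasurable_momentVarHat {Y : ℕ → Ω → ℝ} {b : Ω → EuclideanSpace ℝ (Fin d)}
    (hI : ∀ i, AEMeasurable (I i) P) (hY : ∀ i, AEMeasurable (Y i) P)
    (hI' : ∀ i, AEMeasurable (I' i) P) (hX : ∀ i, AEMeasurable (X i) P) (hb : AEMeasurable b P) :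
    AEMeasurable (fun ω => momentVarHat n n' (fun i => I i ω) (fun i => Y i ω)
      (fun i => I' i ω) (fun i => X i ω) (b ω)) P := by
  have hYI : AEMeasurable (fun ω => empVar n fun i => Y i ω • I i ω) P :=
    aemeasurable_empVar fun i => (hY i).smul (hI i)
  have hXbI : AEMeasurable (fun ω => empVar n' fun j => (X j ω ⬝ᵥ (b ω).ofLp) • I' j ω) P :=
    aemeasurable_empVar fun j => (aemeasurable_dotProduct (hX j)
      ((WithLp.measurable_ofLp 2 _).comp_aemeasurable hb)).smul (hI' j)
  exact (hYI.const_smul ((n : ℝ) / ((n : ℝ) + n'))⁻¹).add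
    (hXbI.const_smul ((n' : ℝ) / ((n : ℝ) + n'))⁻¹)

end Measurability

end SampleMoments

section PopulationMoments

variable {S : Type*} [MeasurableSpace S] {μ : Measure S} [IsProbabilityMeasure μ] {m d : ℕ}
  {I : S → Fin m → ℝ} {X : S → Fin d → ℝ}

theorem crossCov_apply_of_centered (hI : ∀ a, CenteredLp 2 μ fun s => I s a)
    (hX : ∀ b, MemLp (fun s => X s b) 2 μ) (a : Fin m) (b : Fin d) :
    crossCov μ I X a b = ∫ s, I s a * X s b ∂μ := by
  rw [crossCov, Matrix.of_apply, covariance_eq_sub (hI a).memLp (hX b), (hI a).integral_eq_zero,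
    zero_mul, sub_zero]
  rfl

theorem crossCov_mulVec_apply (hI : ∀ a, CenteredLp 2 μ fun s => I s a)
    (hX : ∀ b, MemLp (fun s => X s b) 2 μ) (β : Fin d → ℝ) (a : Fin m) :
    (crossCov μ I X *ᵥ β) a = ∫ s, (X s ⬝ᵥ β) * I s a ∂μ := by
  simp only [mul_comm _ (I _ a), mulVec, funext fun b => crossCov_apply_of_centered hI hX a b]
  exact (integral_mul_dotProduct (fun b => (hI a).memLp.integrable_mul (hX b)) β).symm

theorem varMatrix_apply {A : S → Fin m → ℝ} (hA : ∀ a, MemLp (fun s => A s a) 2 μ) (a b : Fin m) :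
    varMatrix μ A a b = (∫ s, A s a * A s b ∂μ) - (∫ s, A s a ∂μ) * ∫ s, A s b ∂μ :=
  covariance_eq_sub (hA a) (hA b)

theorem posSemidef_momentVar {Y : S → ℝ} {I' : S → Fin m → ℝ}
    (hI : ∀ a, MemLp (fun s => I s a) 4 μ) (hY : MemLp Y 4 μ)
    (hI' : ∀ a, MemLp (fun s => I' s a) 4 μ) (hX : ∀ b, MemLp (fun s => X s b) 4 μ)
    {τ τ' : ℝ} (hτ : 0 < τ) (hτ' : 0 < τ') (β : EuclideanSpace ℝ (Fin d)) :
    (momentVar μ τ τ' I Y I' X β).PosSemidef :=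
  ((posSemidef_varMatrix fun a => memLp_two_mul hY (hI a)).smul (inv_nonneg.2 hτ.le)).add
    ((posSemidef_varMatrix fun a => memLp_two_mul (memLp_dotProduct hX _) (hI' a)).smul
      (inv_nonneg.2 hτ'.le))

theorem integral_mul_eq_zero_of_condExp_comap_eq_zero {E : Type*} [MeasurableSpace E] {Z : S → E}
    (hZ : Measurable Z) {f : E → ℝ} (hf : Measurable f) {ε : S → ℝ} (hε : Integrable ε μ)
    (hmul : Integrable (fun s => ε s * f (Z s)) μ)
    (hexo : μ[ε | MeasurableSpace.comap Z inferInstance] =ᵐ[μ] 0) :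
    ∫ s, ε s * f (Z s) ∂μ = 0 := by
  have hpull := condExp_mul_of_stronglyMeasurable_right
    (hf.comp (comap_measurable Z)).stronglyMeasurable hmul hε
  rw [← integral_condExp hZ.comap_le]
  refine integral_eq_zero_of_ae (hpull.trans ?_)
  filter_upwards [hexo] with s hs
  rw [Pi.mul_apply, hs, Pi.zero_apply, zero_mul]

theorem integral_mul_eq_crossCov_mulVec {Y ε : S → ℝ} {β : Fin d → ℝ} (hI : Measurable I)
    (hI₂ : ∀ a, CenteredLp 2 μ fun s => I s a) (hX : ∀ b, MemLp (fun s => X s b) 2 μ)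
    (hY : MemLp Y 2 μ) (hYX : ∀ᵐ s ∂μ, Y s = X s ⬝ᵥ β + ε s)
    (hexo : μ[ε | MeasurableSpace.comap I inferInstance] =ᵐ[μ] 0) (a : Fin m) :
    ∫ s, Y s * I s a ∂μ = (crossCov μ I X *ᵥ β) a := by
  have hXβ : MemLp (fun s => X s ⬝ᵥ β) 2 μ := memLp_dotProduct hX β
  have hε : MemLp ε 2 μ := (memLp_congr_ae <| by
    filter_upwards [hYX] with s hs using by simp [hs]).1 (hY.sub hXβ)
  have hXβI : Integrable (fun s => (X s ⬝ᵥ β) * I s a) μ := hXβ.integrable_mul (hI₂ a).memLp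
  have hεI : Integrable (fun s => ε s * I s a) μ := hε.integrable_mul (hI₂ a).memLp
  rw [crossCov_mulVec_apply hI₂ hX, ← add_zero (∫ s, (X s ⬝ᵥ β) * I s a ∂μ),
    ← integral_mul_eq_zero_of_condExp_comap_eq_zero hI (measurable_pi_apply a)
      (hε.integrable one_le_two) hεI hexo, ← integral_add hXβI hεI]
  refine integral_congr_ae ?_
  filter_upwards [hYX] with s hs
  rw [hs, add_mul]

end PopulationMoments

section DeterministicLimits

variable {α S : Type*} {l : Filter α} {m d : ℕ} {n : α → ℕ}

theorem tendsto_avg_mul_dotProduct {u : α → ℕ → ℝ} {w : α → ℕ → Fin d → ℝ} {b : α → Fin d → ℝ}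
    {M β : Fin d → ℝ}
    (hw : ∀ j, Tendsto (fun x => avg (n x) fun i => u x i * w x i j) l (𝓝 (M j)))
    (hb : Tendsto b l (𝓝 β)) :
    Tendsto (fun x => avg (n x) fun i => u x i * (w x i ⬝ᵥ b x)) l (𝓝 (M ⬝ᵥ β)) := by
  simp only [dotProduct, Finset.mul_sum, ← mul_assoc, avg_sum, avg_mul_const]
  exact tendsto_finsetSum _ fun j _ => (hw j).mul (tendsto_pi_nhds.1 hb j)

theorem tendsto_empVar [MeasurableSpace S] {μ : Measure S} [IsProbabilityMeasure μ]
    {v : α → ℕ → Fin m → ℝ} {A : S → Fin m → ℝ} (hA : ∀ a, MemLp (fun s => A s a) 2 μ)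
    (hmean : ∀ a, Tendsto (fun x => avg (n x) fun i => v x i a) l (𝓝 (∫ s, A s a ∂μ)))
    (hprod : ∀ a b, Tendsto (fun x => avg (n x) fun i => v x i a * v x i b) l
      (𝓝 (∫ s, A s a * A s b ∂μ))) :
    Tendsto (fun x => empVar (n x) (v x)) l (𝓝 (varMatrix μ A)) := by
  refine tendsto_pi_nhds.2 fun a => tendsto_pi_nhds.2 fun b => ?_
  simp only [empVar_apply]
  rw [varMatrix_apply hA]
  exact (hprod a b).sub ((hmean a).mul (hmean b))

end DeterministicLimits

section SampleLimits

variable {Ω S : Type*} [MeasurableSpace Ω] [MeasurableSpace S] {P : Measure Ω}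
  [IsProbabilityMeasure P] {μ : Measure S} {m d : ℕ} {n : ℕ → ℕ} {I : S → Fin m → ℝ}
  {Is : ℕ → Ω → Fin m → ℝ} {X : S → Fin d → ℝ} {Xs : ℕ → Ω → Fin d → ℝ} {Y : S → ℝ}
  {Ys : ℕ → Ω → ℝ}

theorem tendsto_inProb_smul_momentIY_obs_sub (c : Centering)
    (h : IIDSample P μ (fun i ω => (Is i ω, Ys i ω)) fun s => (I s, Y s))
    (hI : ∀ a, CenteredLp 1 μ fun s => I s a) (hY : CenteredLp 2 μ Y)
    (hn : Tendsto n atTop atTop) {r : ℕ → ℝ} {v : ℝ}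
    (hr : Tendsto (fun k => r k / √(n k)) atTop (𝓝 v)) :
    Tendsto (fun p : ℕ × Ω => r p.1 • (momentIY (n p.1) (c.obs (n p.1) fun i => Is i p.2)
      (c.obs (n p.1) fun i => Ys i p.2) -
        momentIY (n p.1) (fun i => Is i p.2) fun i => Ys i p.2)) (inProb atTop P) (𝓝 0) := by
  cases c with
  | population => simpa only [Centering.obs, sub_self, smul_zero] using tendsto_const_nhds
  | sampleMean =>
    have hprod := tendsto_pi_nhds.2 fun a => tendsto_inProb_mul_avg_mul_avg
      (h.comp measurable_snd) (h.comp (f := fun z => z.1 a) (by fun_prop)) hY (hI a) hn hn hr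
    simp only [momentIY_obs_sampleMean, sub_sub_cancel_left]
    refine ((neg_zero (G := Fin m → ℝ)) ▸ hprod.neg).congr fun p => ?_
    ext a
    simp [avg_apply]

variable [IsProbabilityMeasure μ]

theorem tendsto_momentIX (c : Centering)
    (h : IIDSample P μ (fun j ω => (Is j ω, Xs j ω)) fun s => (I s, X s))
    (hI : ∀ a, CenteredLp 2 μ fun s => I s a) (hX : ∀ b, CenteredLp 2 μ fun s => X s b)
    (hn : Tendsto n atTop atTop) :
    Tendsto (fun p : ℕ × Ω => momentIX (n p.1) (c.obs (n p.1) fun j => Is j p.2)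
      (c.obs (n p.1) fun j => Xs j p.2)) (inProb atTop P) (𝓝 (crossCov μ I X)) := by
  refine tendsto_pi_nhds.2 fun a => tendsto_pi_nhds.2 fun b => ?_
  simp only [momentIX_apply, obs_apply]
  rw [crossCov_apply_of_centered hI fun b => (hX b).memLp]
  exact tendsto_inProb_avg_obs_mul_obs c h (f := fun z => z.1 a) (g := fun z => z.2 b)
    (by fun_prop) (by fun_prop) (hI a) (hX b) hn

theorem tendsto_avg_dotProduct_mul_mul_dotProduct_mul (c : Centering)
    (h : IIDSample P μ (fun j ω => (Is j ω, Xs j ω)) fun s => (I s, X s))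
    (hI : ∀ a, CenteredLp 4 μ fun s => I s a) (hX : ∀ b, CenteredLp 4 μ fun s => X s b)
    (hn : Tendsto n atTop atTop) {b : ℕ × Ω → Fin d → ℝ} {β : Fin d → ℝ}
    (hb : Tendsto b (inProb atTop P) (𝓝 β)) (a a' : Fin m) :
    Tendsto (fun p : ℕ × Ω => avg (n p.1) fun j =>
      c.obs (n p.1) (fun j => Is j p.2) j a * c.obs (n p.1) (fun j => Is j p.2) j a' *
        (c.obs (n p.1) (fun j => Xs j p.2) j ⬝ᵥ b p) *
        (c.obs (n p.1) (fun j => Xs j p.2) j ⬝ᵥ b p)) (inProb atTop P)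
      (𝓝 (∫ s, I s a * I s a' * (X s ⬝ᵥ β) * (X s ⬝ᵥ β) ∂μ)) := by
  have hII := memLp_two_mul (hI a).memLp (hI a').memLp
  have hXβ := memLp_dotProduct (fun b => (hX b).memLp) β
  have hentry (e e' : Fin d) : Tendsto (fun p : ℕ × Ω => avg (n p.1) fun j =>
      c.obs (n p.1) (fun j => Is j p.2) j a * c.obs (n p.1) (fun j => Is j p.2) j a' *
        c.obs (n p.1) (fun j => Xs j p.2) j e * c.obs (n p.1) (fun j => Xs j p.2) j e')
      (inProb atTop P) (𝓝 (∫ s, I s a * I s a' * X s e * X s e' ∂μ)) := by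
    simp only [obs_apply]
    exact tendsto_inProb_avg_obs_mul_obs_mul_obs_mul_obs c h (f₁ := fun z => z.1 a)
      (f₂ := fun z => z.1 a') (f₃ := fun z => z.2 e) (f₄ := fun z => z.2 e') (by fun_prop)
      (by fun_prop) (by fun_prop) (by fun_prop) (hI a) (hI a') (hX e) (hX e') hn
  have hrow (e : Fin d) : Tendsto (fun p : ℕ × Ω => avg (n p.1) fun j =>
      c.obs (n p.1) (fun j => Is j p.2) j a * c.obs (n p.1) (fun j => Is j p.2) j a' *
        (c.obs (n p.1) (fun j => Xs j p.2) j ⬝ᵥ b p) * c.obs (n p.1) (fun j => Xs j p.2) j e)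
      (inProb atTop P) (𝓝 (∫ s, I s a * I s a' * (X s ⬝ᵥ β) * X s e ∂μ)) := by
    have hlimit := integral_mul_dotProduct (u := fun s => I s a * I s a' * X s e) (X := X)
      (fun e' => by
        simp only [mul_assoc _ (X _ e)]
        exact hII.integrable_mul (memLp_two_mul (hX e).memLp (hX e').memLp)) β
    simp only [mul_right_comm _ (_ ⬝ᵥ _), hlimit]
    exact tendsto_avg_mul_dotProduct (hentry e) hb
  rw [integral_mul_dotProduct fun e => by
    simp only [mul_assoc _ (X _ ⬝ᵥ β)]
    exact hII.integrable_mul (memLp_two_mul hXβ (hX e).memLp)]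
  exact tendsto_avg_mul_dotProduct hrow hb

theorem tendsto_empVar_dotProduct_smul (c : Centering)
    (h : IIDSample P μ (fun j ω => (Is j ω, Xs j ω)) fun s => (I s, X s))
    (hI : ∀ a, CenteredLp 4 μ fun s => I s a) (hX : ∀ b, CenteredLp 4 μ fun s => X s b)
    (hn : Tendsto n atTop atTop) {b : ℕ × Ω → Fin d → ℝ} {β : Fin d → ℝ}
    (hb : Tendsto b (inProb atTop P) (𝓝 β)) :
    Tendsto (fun p : ℕ × Ω => empVar (n p.1) fun j =>
      (c.obs (n p.1) (fun j => Xs j p.2) j ⬝ᵥ b p) • c.obs (n p.1) (fun j => Is j p.2) j)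
      (inProb atTop P) (𝓝 (varMatrix μ fun s => (X s ⬝ᵥ β) • I s)) := by
  have hI₂ (a : Fin m) : CenteredLp 2 μ fun s => I s a := (hI a).mono (by norm_num)
  have hX₂ (e : Fin d) : CenteredLp 2 μ fun s => X s e := (hX e).mono (by norm_num)
  refine tendsto_empVar
    (fun a => memLp_two_mul (memLp_dotProduct (fun e => (hX e).memLp) β) (hI a).memLp)
    (fun a => ?_) fun a a' => ?_
  · have hmoment := tendsto_pi_nhds.1
      (tendsto_matrix_mulVec (tendsto_momentIX c h hI₂ hX₂ hn) hb) a
    rw [crossCov_mulVec_apply hI₂ fun e => (hX₂ e).memLp] at hmoment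
    simpa only [momentIX_mulVec, momentIY, avg_apply, Pi.smul_apply, smul_eq_mul] using hmoment
  · simpa only [Pi.smul_apply, smul_eq_mul, mul_comm, mul_left_comm, mul_assoc] using
      tendsto_avg_dotProduct_mul_mul_dotProduct_mul c h hI hX hn hb a a'

theorem tendsto_momentIY (c : Centering)
    (h : IIDSample P μ (fun i ω => (Is i ω, Ys i ω)) fun s => (I s, Y s))
    (hI : ∀ a, CenteredLp 2 μ fun s => I s a) (hY : CenteredLp 2 μ Y)
    (hn : Tendsto n atTop atTop) :
    Tendsto (fun p : ℕ × Ω => momentIY (n p.1) (c.obs (n p.1) fun i => Is i p.2)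
      (c.obs (n p.1) fun i => Ys i p.2)) (inProb atTop P) (𝓝 fun a => ∫ s, Y s * I s a ∂μ) := by
  refine tendsto_pi_nhds.2 fun a => ?_
  simp only [momentIY, avg_apply, Pi.smul_apply, smul_eq_mul, obs_apply]
  exact tendsto_inProb_avg_obs_mul_obs c h (f := fun z => z.2) (g := fun z => z.1 a)
    (by fun_prop) (by fun_prop) hY (hI a) hn

theorem tendsto_empVar_smul (c : Centering)
    (h : IIDSample P μ (fun i ω => (Is i ω, Ys i ω)) fun s => (I s, Y s))
    (hI : ∀ a, CenteredLp 4 μ fun s => I s a) (hY : CenteredLp 4 μ Y)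
    (hn : Tendsto n atTop atTop) :
    Tendsto (fun p : ℕ × Ω => empVar (n p.1) fun i =>
      c.obs (n p.1) (fun i => Ys i p.2) i • c.obs (n p.1) (fun i => Is i p.2) i)
      (inProb atTop P) (𝓝 (varMatrix μ fun s => Y s • I s)) := by
  simpa [dotProduct, obs_apply] using tendsto_empVar_dotProduct_smul c
    (h.comp (f := fun z => (z.1, fun _ : Fin 1 => z.2)) (by fun_prop)) hI (fun _ => hY) hn
    (tendsto_const_nhds (x := fun _ => 1))

end SampleLimits

section SampleMomentLimits

variable {m d : ℕ} {S Ω : Type*} [MeasurableSpace S] {μ : Measure S} [MeasurableSpace Ω]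
  {P : Measure Ω} {I I' : S → Fin m → ℝ} {Is Is' : ℕ → Ω → Fin m → ℝ} {Y : S → ℝ}
  {Ys : ℕ → Ω → ℝ} {X' : S → Fin d → ℝ} {Xs' : ℕ → Ω → Fin d → ℝ} {n n' : ℕ → ℕ}

theorem tendsto_sqrt_div_sqrt {α : Type*} {l : Filter α} {f g : α → ℝ} {τ : ℝ} (hτ : 0 < τ)
    (hf : ∀ x, 0 ≤ f x) (h : Tendsto (fun x => f x / g x) l (𝓝 τ)) :
    Tendsto (fun x => √(g x) / √(f x)) l (𝓝 (√τ)⁻¹) := by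
  simpa only [Real.sqrt_div (hf _), inv_div] using h.sqrt.inv₀ (Real.sqrt_pos.2 hτ).ne'

theorem sampleMoment_eq_sub (n n' : ℕ) (I : ℕ → Fin m → ℝ) (Y : ℕ → ℝ) (I' : ℕ → Fin m → ℝ)
    (X' : ℕ → Fin d → ℝ) (β : EuclideanSpace ℝ (Fin d)) :
    sampleMoment n n' I Y I' X' β = momentIY n I Y - momentIY n' I' fun j => X' j ⬝ᵥ β.ofLp := by
  rw [sampleMoment, momentIX_mulVec]

theorem aemeasurable_momentIY {n : ℕ} (hI : ∀ i, AEMeasurable (Is i) P)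
    (hY : ∀ i, AEMeasurable (Ys i) P) :
    AEMeasurable (fun ω => momentIY n (fun i => Is i ω) fun i => Ys i ω) P :=
  aemeasurable_avg fun i => (hY i).smul (hI i)

variable [IsProbabilityMeasure P] [IsProbabilityMeasure μ]

theorem tendstoInDistribution_smul_momentIY_obs_sub {Y' : S → ℝ} {Ys' : ℕ → Ω → ℝ} (c : Centering)
    (h : IIDSample P μ (fun i ω => (Is i ω, Ys i ω)) fun s => (I s, Y s))
    (h' : IIDSample P μ (fun j ω => (Is' j ω, Ys' j ω)) fun s => (I' s, Y' s))
    (hindep : IndepFun (fun ω i => (Is i ω, Ys i ω)) (fun ω j => (Is' j ω, Ys' j ω)) P)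
    (hI : ∀ a, CenteredLp 4 μ fun s => I s a) (hY : CenteredLp 4 μ Y)
    (hI' : ∀ a, CenteredLp 4 μ fun s => I' s a) (hY' : CenteredLp 4 μ Y')
    (hmean : ∀ a, ∫ s, Y s * I s a ∂μ = ∫ s, Y' s * I' s a ∂μ) (hn : Tendsto n atTop atTop)
    (hn' : Tendsto n' atTop atTop) {r : ℕ → ℝ} {v v' : ℝ}
    (hr : Tendsto (fun k => r k / √(n k)) atTop (𝓝 v))
    (hr' : Tendsto (fun k => r k / √(n' k)) atTop (𝓝 v')) :
    TendstoInDistribution (fun k ω => r k • WithLp.toLp 2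
        (momentIY (n k) (c.obs (n k) fun i => Is i ω) (c.obs (n k) fun i => Ys i ω) -
          momentIY (n' k) (c.obs (n' k) fun j => Is' j ω) (c.obs (n' k) fun j => Ys' j ω)))
      atTop id (fun _ => P) (multivariateGaussian 0
        (v ^ 2 • varMatrix μ (fun s => Y s • I s) +
          v' ^ 2 • varMatrix μ fun s => Y' s • I' s)) := by
  have hsmul : Measurable fun z : (Fin m → ℝ) × ℝ => z.2 • z.1 := by fun_prop
  have hsmul_seq : Measurable fun (z : ℕ → (Fin m → ℝ) × ℝ) i => (z i).2 • (z i).1 := by fun_prop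
  have hpopulation := tendstoInDistribution_smul_avg_sub_avg (h.comp hsmul) (h'.comp hsmul)
    (hindep.comp hsmul_seq hsmul_seq) (fun a => memLp_two_mul hY.memLp (hI a).memLp)
    (fun a => memLp_two_mul hY'.memLp (hI' a).memLp) hmean hn hn' hr hr'
  have hcentering := (tendsto_inProb_smul_momentIY_obs_sub c h (fun a => (hI a).mono (by norm_num))
    (hY.mono (by norm_num)) hn hr).sub (tendsto_inProb_smul_momentIY_obs_sub c h'
    (fun a => (hI' a).mono (by norm_num)) (hY'.mono (by norm_num)) hn' hr')
  refine tendstoInDistribution_of_tendstoInMeasure_sub _ _ hpopulation ?_ fun k => ?_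
  · have hlimit := ((PiLp.continuous_toLp 2 fun _ : Fin m => ℝ).tendsto _).comp hcentering
    rw [sub_zero, WithLp.toLp_zero] at hlimit
    refine tendstoInMeasure_const_iff.2 (hlimit.congr fun p => ?_)
    simp only [Pi.sub_apply, Function.comp_apply, momentIY, ← smul_sub,
      ← WithLp.toLp_sub, ← WithLp.toLp_smul, sub_sub_sub_comm]
  · exact ((WithLp.measurable_toLp 2 _).comp_aemeasurable ((aemeasurable_momentIY
      (h.aemeasurable_obs_fst c _) (h.aemeasurable_obs_snd c _)).sub (aemeasurable_momentIY
      (h'.aemeasurable_obs_fst c _) (h'.aemeasurable_obs_snd c _)))).const_smul (r k)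

variable {τ τ' : ℝ} {β : EuclideanSpace ℝ (Fin d)}

theorem tendstoInDistribution_sampleMoment (c : Centering)
    (h : IIDSample P μ (fun i ω => (Is i ω, Ys i ω)) fun s => (I s, Y s))
    (h' : IIDSample P μ (fun j ω => (Is' j ω, Xs' j ω)) fun s => (I' s, X' s))
    (hindep : IndepFun (fun ω i => (Is i ω, Ys i ω)) (fun ω j => (Is' j ω, Xs' j ω)) P)
    (hI : ∀ a, CenteredLp 4 μ fun s => I s a) (hY : CenteredLp 4 μ Y)
    (hI' : ∀ a, CenteredLp 4 μ fun s => I' s a) (hX' : ∀ b, CenteredLp 4 μ fun s => X' s b)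
    (hmoment : ∀ a, ∫ s, Y s * I s a ∂μ = (crossCov μ I' X' *ᵥ β.ofLp) a)
    (hn : Tendsto n atTop atTop) (hn' : Tendsto n' atTop atTop) (hτ : 0 < τ) (hτ' : 0 < τ')
    (hnτ : Tendsto (fun k => (n k : ℝ) / ((n k : ℝ) + n' k)) atTop (𝓝 τ))
    (hnτ' : Tendsto (fun k => (n' k : ℝ) / ((n k : ℝ) + n' k)) atTop (𝓝 τ')) :
    TendstoInDistribution (fun k ω => √((n k : ℝ) + n' k) • WithLp.toLp 2
      (sampleMoment (n k) (n' k) (c.obs (n k) fun i => Is i ω) (c.obs (n k) fun i => Ys i ω)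
        (c.obs (n' k) fun j => Is' j ω) (c.obs (n' k) fun j => Xs' j ω) β)) atTop id
      (fun _ => P) (multivariateGaussian 0 (momentVar μ τ τ' I Y I' X' β)) := by
  have hdot : Measurable fun z : (Fin m → ℝ) × (Fin d → ℝ) => (z.1, z.2 ⬝ᵥ β.ofLp) := by
    simp only [dotProduct]
    fun_prop
  have hdot_seq : Measurable fun (z : ℕ → (Fin m → ℝ) × (Fin d → ℝ)) j =>
      ((z j).1, (z j).2 ⬝ᵥ β.ofLp) :=
    measurable_pi_lambda _ fun j => hdot.comp (measurable_pi_apply j)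
  have hmean (a : Fin m) : ∫ s, Y s * I s a ∂μ = ∫ s, (X' s ⬝ᵥ β.ofLp) * I' s a ∂μ := by
    rw [hmoment, crossCov_mulVec_apply (fun a => (hI' a).mono (by norm_num))
      fun b => (hX' b).memLp.mono_exponent (by norm_num)]
  have hclt := tendstoInDistribution_smul_momentIY_obs_sub c h (h'.comp hdot)
    (hindep.comp measurable_id hdot_seq) hI hY hI' (centeredLp_dotProduct (by norm_num) hX' β.ofLp)
    hmean hn hn' (tendsto_sqrt_div_sqrt hτ (fun k => (n k).cast_nonneg) hnτ)
    (tendsto_sqrt_div_sqrt hτ' (fun k => (n' k).cast_nonneg) hnτ')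
  simpa only [sampleMoment_eq_sub, obs_dotProduct, momentVar, inv_pow, Real.sq_sqrt hτ.le,
    Real.sq_sqrt hτ'.le] using hclt

theorem tendsto_sampleMoment (c : Centering)
    (h : IIDSample P μ (fun i ω => (Is i ω, Ys i ω)) fun s => (I s, Y s))
    (h' : IIDSample P μ (fun j ω => (Is' j ω, Xs' j ω)) fun s => (I' s, X' s))
    (hI : ∀ a, CenteredLp 2 μ fun s => I s a) (hY : CenteredLp 2 μ Y)
    (hI' : ∀ a, CenteredLp 2 μ fun s => I' s a) (hX' : ∀ b, CenteredLp 2 μ fun s => X' s b)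
    (hmoment : ∀ a, ∫ s, Y s * I s a ∂μ = (crossCov μ I' X' *ᵥ β.ofLp) a)
    (hn : Tendsto n atTop atTop) (hn' : Tendsto n' atTop atTop) :
    Tendsto (fun p : ℕ × Ω => sampleMoment (n p.1) (n' p.1) (c.obs (n p.1) fun i => Is i p.2)
      (c.obs (n p.1) fun i => Ys i p.2) (c.obs (n' p.1) fun j => Is' j p.2)
      (c.obs (n' p.1) fun j => Xs' j p.2) β) (inProb atTop P) (𝓝 0) := by
  have hlimit := (tendsto_momentIY c h hI hY hn).sub
    (tendsto_matrix_mulVec (tendsto_momentIX c h' hI' hX' hn') (tendsto_const_nhds (x := β.ofLp)))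
  rwa [funext hmoment, sub_self] at hlimit

theorem tendsto_momentVarHat (c : Centering)
    (h : IIDSample P μ (fun i ω => (Is i ω, Ys i ω)) fun s => (I s, Y s))
    (h' : IIDSample P μ (fun j ω => (Is' j ω, Xs' j ω)) fun s => (I' s, X' s))
    (hI : ∀ a, CenteredLp 4 μ fun s => I s a) (hY : CenteredLp 4 μ Y)
    (hI' : ∀ a, CenteredLp 4 μ fun s => I' s a) (hX' : ∀ b, CenteredLp 4 μ fun s => X' s b)
    (hn : Tendsto n atTop atTop) (hn' : Tendsto n' atTop atTop) (hτ : 0 < τ) (hτ' : 0 < τ')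
    (hnτ : Tendsto (fun k => (n k : ℝ) / ((n k : ℝ) + n' k)) atTop (𝓝 τ))
    (hnτ' : Tendsto (fun k => (n' k : ℝ) / ((n k : ℝ) + n' k)) atTop (𝓝 τ'))
    {b : ℕ → Ω → EuclideanSpace ℝ (Fin d)} (hb : TendstoInMeasure P b atTop fun _ => β) :
    Tendsto (fun p : ℕ × Ω => momentVarHat (n p.1) (n' p.1) (c.obs (n p.1) fun i => Is i p.2)
      (c.obs (n p.1) fun i => Ys i p.2) (c.obs (n' p.1) fun j => Is' j p.2)
      (c.obs (n' p.1) fun j => Xs' j p.2) (b p.1 p.2)) (inProb atTop P)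
      (𝓝 (momentVar μ τ τ' I Y I' X' β)) := by
  have hbLim : Tendsto (fun p : ℕ × Ω => (b p.1 p.2).ofLp) (inProb atTop P) (𝓝 β.ofLp) :=
    ((PiLp.continuous_ofLp 2 _).tendsto β).comp (tendstoInMeasure_const_iff.1 hb)
  exact (((hnτ.inv₀ hτ.ne').comp tendsto_fst_inProb).smul (tendsto_empVar_smul c h hI hY hn)).add
    (((hnτ'.inv₀ hτ'.ne').comp tendsto_fst_inProb).smul
      (tendsto_empVar_dotProduct_smul c h' hI' hX' hn' hbLim))

end SampleMomentLimits

section Estimator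

variable {m d : ℕ}

theorem IsGMM.sub_eq_gmmMatrix_mulVec {W : Matrix (Fin m) (Fin m) ℝ} {n n' : ℕ}
    {I : ℕ → Fin m → ℝ} {Y : ℕ → ℝ} {I' : ℕ → Fin m → ℝ} {X' : ℕ → Fin d → ℝ}
    {b : EuclideanSpace ℝ (Fin d)} (h : IsGMM W n n' I Y I' X' b) (hW : W.PosDef)
    (hdet : ((momentIX n' I' X')ᵀ * W * momentIX n' I' X').det ≠ 0)
    (β : EuclideanSpace ℝ (Fin d)) :
    (b - β).ofLp = gmmMatrix (momentIX n' I' X') W *ᵥ sampleMoment n n' I Y I' X' β := by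
  have hb := eq_gmmMatrix_mulVec_of_isMinOn hW hdet (g := momentIY n I Y) (w := b.ofLp)
    fun w _ => h (Set.mem_univ (WithLp.toLp 2 w))
  rw [sampleMoment, mulVec_sub, ← hb, mulVec_mulVec, gmmMatrix_mul hdet, one_mulVec,
    WithLp.ofLp_sub]

variable {α Ω : Type*} {l : Filter α} [MeasurableSpace Ω] {P : Measure Ω}
  [IsProbabilityMeasure P] {C₀ : Matrix (Fin m) (Fin d) ℝ} {b : α → Ω → EuclideanSpace ℝ (Fin d)}
  {β : EuclideanSpace ℝ (Fin d)}

section Weighted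

variable {n n' : α → ℕ} {I I' : α → Ω → ℕ → Fin m → ℝ} {Y : α → Ω → ℕ → ℝ}
  {X' : α → Ω → ℕ → Fin d → ℝ} {W : α → Ω → Matrix (Fin m) (Fin m) ℝ}
  {W₀ : Matrix (Fin m) (Fin m) ℝ}

theorem eventually_sub_eq_gmmMatrix_mulVec_of_isGMM
    (hb : ∀ k, ∀ᵐ ω ∂P, (W k ω).PosDef →
      IsGMM (W k ω) (n k) (n' k) (I k ω) (Y k ω) (I' k ω) (X' k ω) (b k ω))
    (hWm : ∀ k, AEMeasurable (W k) P)
    (hWpos : Tendsto (fun k => P {ω | (W k ω).PosDef}) l (𝓝 1))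
    (hC : Tendsto (fun p : α × Ω => momentIX (n' p.1) (I' p.1 p.2) (X' p.1 p.2)) (inProb l P)
      (𝓝 C₀))
    (hW : Tendsto (fun p : α × Ω => W p.1 p.2) (inProb l P) (𝓝 W₀))
    (hdet : (C₀ᵀ * W₀ * C₀).det ≠ 0) :
    ∀ᶠ p in inProb l P, (b p.1 p.2 - β).ofLp =
      gmmMatrix (momentIX (n' p.1) (I' p.1 p.2) (X' p.1 p.2)) (W p.1 p.2) *ᵥ
        sampleMoment (n p.1) (n' p.1) (I p.1 p.2) (Y p.1 p.2) (I' p.1 p.2) (X' p.1 p.2) β := by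
  have hposDef : ∀ᶠ p : α × Ω in inProb l P, (W p.1 p.2).PosDef :=
    eventually_inProb_of_tendsto_one (s := fun k => {ω | (W k ω).PosDef})
      (fun k => (hWm k).nullMeasurable measurableSet_posDef) hWpos
  filter_upwards [hposDef, eventually_inProb_of_ae hb,
    (tendsto_matrix_det (tendsto_gram hC hW)).eventually_ne hdet] with p hpos hgmm hgram
  exact (hgmm hpos).sub_eq_gmmMatrix_mulVec hpos hgram β

theorem tendstoInMeasure_of_isGMM
    (hb : ∀ k, ∀ᵐ ω ∂P, (W k ω).PosDef →
      IsGMM (W k ω) (n k) (n' k) (I k ω) (Y k ω) (I' k ω) (X' k ω) (b k ω))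
    (hWm : ∀ k, AEMeasurable (W k) P)
    (hWpos : Tendsto (fun k => P {ω | (W k ω).PosDef}) l (𝓝 1))
    (hC : Tendsto (fun p : α × Ω => momentIX (n' p.1) (I' p.1 p.2) (X' p.1 p.2)) (inProb l P)
      (𝓝 C₀))
    (hW : Tendsto (fun p : α × Ω => W p.1 p.2) (inProb l P) (𝓝 W₀))
    (hdet : (C₀ᵀ * W₀ * C₀).det ≠ 0)
    (hg : Tendsto (fun p : α × Ω => sampleMoment (n p.1) (n' p.1) (I p.1 p.2) (Y p.1 p.2)
      (I' p.1 p.2) (X' p.1 p.2) β) (inProb l P) (𝓝 0)) :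
    TendstoInMeasure P b l fun _ => β := by
  have herror : Tendsto (fun p : α × Ω => (b p.1 p.2 - β).ofLp) (inProb l P) (𝓝 0) :=
    mulVec_zero (gmmMatrix C₀ W₀) ▸ (tendsto_matrix_mulVec (tendsto_gmmMatrix hC hW hdet)
      hg).congr' ((eventually_sub_eq_gmmMatrix_mulVec_of_isGMM hb hWm hWpos hC hW hdet).mono
        fun _ h => h.symm)
  have hlimit := (((PiLp.continuous_toLp 2 fun _ : Fin d => ℝ).tendsto 0).comp herror).add_const β
  rw [WithLp.toLp_zero, zero_add] at hlimit
  exact tendstoInMeasure_const_iff.2 (hlimit.congr fun p => sub_add_cancel (b p.1 p.2) β)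

theorem tendstoInDistribution_of_isGMM [l.IsCountablyGenerated] {r : α → ℝ}
    {A : Matrix (Fin m) (Fin m) ℝ} (hA : A.PosSemidef)
    (hb : ∀ k, ∀ᵐ ω ∂P, (W k ω).PosDef →
      IsGMM (W k ω) (n k) (n' k) (I k ω) (Y k ω) (I' k ω) (X' k ω) (b k ω))
    (hWm : ∀ k, AEMeasurable (W k) P)
    (hWpos : Tendsto (fun k => P {ω | (W k ω).PosDef}) l (𝓝 1))
    (hC : Tendsto (fun p : α × Ω => momentIX (n' p.1) (I' p.1 p.2) (X' p.1 p.2)) (inProb l P)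
      (𝓝 C₀))
    (hW : Tendsto (fun p : α × Ω => W p.1 p.2) (inProb l P) (𝓝 W₀))
    (hCm : ∀ k, AEMeasurable (fun ω => momentIX (n' k) (I' k ω) (X' k ω)) P)
    (hW₀ : W₀ᵀ = W₀) (hdet : (C₀ᵀ * W₀ * C₀).det ≠ 0)
    (hg : TendstoInDistribution (fun k ω => r k • WithLp.toLp 2
      (sampleMoment (n k) (n' k) (I k ω) (Y k ω) (I' k ω) (X' k ω) β)) l id (fun _ => P)
      (multivariateGaussian 0 A))
    (hbm : ∀ k, AEMeasurable (b k) P) :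
    TendstoInDistribution (fun k ω => r k • (b k ω - β)) l id (fun _ => P)
      (multivariateGaussian 0 (sandwich C₀ A W₀)) := by
  have hslutsky := tendstoInDistribution_mulVec
    (M := fun k ω => gmmMatrix (momentIX (n' k) (I' k ω) (X' k ω)) (W k ω)) hA hg
    (tendsto_gmmMatrix hC hW hdet) fun k => aemeasurable_gmmMatrix (hCm k) (hWm k)
  rw [← sandwich_eq hW₀, WithLp.ofLp_zero, mulVec_zero, WithLp.toLp_zero] at hslutsky
  refine tendstoInDistribution_of_eventually_eq hslutsky
    (fun k => ((hbm k).sub_const β).const_smul (r k)) ?_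
  filter_upwards [eventually_sub_eq_gmmMatrix_mulVec_of_isGMM (β := β) hb hWm hWpos hC hW hdet]
    with p hp
  rw [WithLp.ofLp_smul, mulVec_smul, WithLp.toLp_smul, ← hp, WithLp.toLp_ofLp]

end Weighted

theorem tendstoInDistribution_invSqrt_sandwich_inv [l.IsCountablyGenerated] {r : α → ℝ}
    {C : α → Ω → Matrix (Fin m) (Fin d) ℝ} {A : α → Ω → Matrix (Fin m) (Fin m) ℝ}
    {A₀ : Matrix (Fin m) (Fin m) ℝ} (hA₀ : A₀.PosDef)
    (hCm : ∀ k, AEMeasurable (C k) P) (hAm : ∀ k, AEMeasurable (A k) P)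
    (hC : Tendsto (fun p : α × Ω => C p.1 p.2) (inProb l P) (𝓝 C₀))
    (hA : Tendsto (fun p : α × Ω => A p.1 p.2) (inProb l P) (𝓝 A₀))
    (hpsd : ∀ k ω, (A k ω).PosSemidef)
    (hdet : (C₀ᵀ * A₀⁻¹ * C₀).det ≠ 0)
    (hb : TendstoInDistribution (fun k ω => r k • (b k ω - β)) l id (fun _ => P)
      (multivariateGaussian 0 (sandwich C₀ A₀ A₀⁻¹))) :
    TendstoInDistribution (fun k ω => r k • Matrix.toEuclideanCLM (𝕜 := ℝ)
      (invSqrt (sandwich (C k ω) (A k ω) (A k ω)⁻¹)) (b k ω - β)) l id (fun _ => P)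
      (multivariateGaussian 0 1) := by
  have hV := posDef_sandwich_inv hA₀ hdet
  have hslutsky := tendstoInDistribution_mulVec
    (M := fun k ω => invSqrt (sandwich (C k ω) (A k ω) (A k ω)⁻¹)) hV.posSemidef hb
    (tendsto_invSqrt_sandwich_inv hC hA (fun p => hpsd p.1 p.2) hA₀ hdet)
    fun k => aemeasurable_invSqrt_sandwich_inv (hCm k) (hAm k) (hpsd k)
  rw [transpose_invSqrt, invSqrt_mul_mul_invSqrt hV, WithLp.ofLp_zero, mulVec_zero,
    WithLp.toLp_zero] at hslutsky
  convert! hslutsky using 3 with k ω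
  rw [← map_smul]
  rfl

end Estimator

end UnpairedIV

end

open UnpairedIV in
theorem mainTheorem9_general {m d : ℕ} {S : Type*} [MeasurableSpace S] (μ : Measure S)
    [IsProbabilityMeasure μ] (I It : S → Fin m → ℝ) (Xt : S → Fin d → ℝ) (Y : S → ℝ)
    (β : EuclideanSpace ℝ (Fin d))
    (hI : ∀ a, CenteredLp 4 μ fun s => I s a) (hY : CenteredLp 4 μ Y)
    (hIt : ∀ a, CenteredLp 4 μ fun s => It s a) (hXt : ∀ b, CenteredLp 4 μ fun s => Xt s b)
    (hmoment : ∀ a, ∫ s, Y s * I s a ∂μ = (crossCov μ It Xt *ᵥ β.ofLp) a)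
    (hrank : (crossCov μ It Xt).rank = d)
    {P₀ : Type*} [MeasurableSpace P₀] (P : Measure P₀) [IsProbabilityMeasure P]
    (Is : ℕ → P₀ → Fin m → ℝ) (Ys : ℕ → P₀ → ℝ)
    (Its : ℕ → P₀ → Fin m → ℝ) (Xts : ℕ → P₀ → Fin d → ℝ)
    (h : IIDSample P μ (fun i ω => (Is i ω, Ys i ω)) fun s => (I s, Y s))
    (ht : IIDSample P μ (fun j ω => (Its j ω, Xts j ω)) fun s => (It s, Xt s))
    (hindep : IndepFun (fun ω i => (Is i ω, Ys i ω)) (fun ω j => (Its j ω, Xts j ω)) P)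
    (n nt : ℕ → ℕ) (hn : Tendsto n atTop atTop) (hnt : Tendsto nt atTop atTop)
    (τ τt : ℝ) (hτ : 0 < τ) (hτt : 0 < τt)
    (hnτ : Tendsto (fun k => (n k : ℝ) / ((n k : ℝ) + nt k)) atTop (𝓝 τ))
    (hntτ : Tendsto (fun k => (nt k : ℝ) / ((n k : ℝ) + nt k)) atTop (𝓝 τt))
    (W : ℕ → P₀ → Matrix (Fin m) (Fin m) ℝ) (W0 : Matrix (Fin m) (Fin m) ℝ)
    (hWm : ∀ k a b, AEMeasurable (fun ω => W k ω a b) P)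
    (hWpos : Tendsto (fun k => P {ω | (W k ω).PosDef}) atTop (𝓝 1)) (hW0 : W0.PosDef)
    (hW : ∀ a b, TendstoInMeasure P (fun k ω => W k ω a b) atTop fun _ => W0 a b)
    (c : Centering) (βhat : ℕ → P₀ → EuclideanSpace ℝ (Fin d))
    (hβm : ∀ k, AEMeasurable (βhat k) P)
    (hβ : ∀ k, ∀ᵐ ω ∂P, (W k ω).PosDef → IsGMM (W k ω) (n k) (nt k)
      (c.obs (n k) fun i => Is i ω) (c.obs (n k) fun i => Ys i ω)
      (c.obs (nt k) fun j => Its j ω) (c.obs (nt k) fun j => Xts j ω) (βhat k ω)) :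
    let Ω := momentVar μ τ τt I Y It Xt β
    let V := fun W' => sandwich (crossCov μ It Xt) Ω W'
    TendstoInMeasure P βhat atTop (fun _ => β) ∧
    TendstoInDistribution (fun k ω => √((n k : ℝ) + nt k) • (βhat k ω - β)) atTop id
      (fun _ => P) (multivariateGaussian 0 (V W0)) ∧
    (Ω.PosDef → ∀ W' : Matrix (Fin m) (Fin m) ℝ, W'.PosDef → (V W' - V Ω⁻¹).PosSemidef) ∧
    (Ω.PosDef → W0 = Ω⁻¹ →
      ∀ β₀ : ℕ → P₀ → EuclideanSpace ℝ (Fin d), (∀ k, AEMeasurable (β₀ k) P) →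
        TendstoInMeasure P β₀ atTop (fun _ => β) →
        TendstoInDistribution
          (fun k ω => √((n k : ℝ) + nt k) •
            Matrix.toEuclideanCLM (𝕜 := ℝ) (invSqrt (asymVarHat (n k) (nt k)
              (c.obs (n k) fun i => Is i ω) (c.obs (n k) fun i => Ys i ω)
              (c.obs (nt k) fun j => Its j ω) (c.obs (nt k) fun j => Xts j ω) (β₀ k ω)))
              (βhat k ω - β))
          atTop id (fun _ => P) (multivariateGaussian 0 1)) := by
  intro Ω V
  have hI₂ (a : Fin m) : CenteredLp 2 μ fun s => I s a := (hI a).mono (by norm_num)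
  have hIt₂ (a : Fin m) : CenteredLp 2 μ fun s => It s a := (hIt a).mono (by norm_num)
  have hXt₂ (b : Fin d) : CenteredLp 2 μ fun s => Xt s b := (hXt b).mono (by norm_num)
  have hC := tendsto_momentIX c ht hIt₂ hXt₂ hnt
  have hCm (k : ℕ) := aemeasurable_momentIX (n := nt k) (ht.aemeasurable_obs_fst c (nt k))
    (ht.aemeasurable_obs_snd c (nt k))
  have hWlim : Tendsto (fun p : ℕ × P₀ => W p.1 p.2) (inProb atTop P) (𝓝 W0) :=
    tendsto_pi_nhds.2 fun a => tendsto_pi_nhds.2 fun b => (tendstoInMeasure_const_iff.1 (hW a b) :)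
  have hWmeas (k : ℕ) : AEMeasurable (W k) P :=
    aemeasurable_pi_lambda _ fun a => aemeasurable_pi_lambda _ fun b => hWm k a b
  have hdet : ((crossCov μ It Xt)ᵀ * W0 * crossCov μ It Xt).det ≠ 0 := (posDef_gram
    (mulVec_injective_of_rank_eq_card (hrank.trans (Fintype.card_fin d).symm)) hW0).det_pos.ne'
  have hΩ : Ω.PosSemidef := posSemidef_momentVar (fun a => (hI a).memLp) hY.memLp
    (fun a => (hIt a).memLp) (fun b => (hXt b).memLp) hτ hτt β
  have hconsistent := tendstoInMeasure_of_isGMM hβ hWmeas hWpos hC hWlim hdet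
    (tendsto_sampleMoment c h ht hI₂ (hY.mono (by norm_num)) hIt₂ hXt₂ hmoment hn hnt)
  have hnormal := tendstoInDistribution_of_isGMM hΩ hβ hWmeas hWpos hC hWlim hCm
    (transpose_eq_of_posDef hW0) hdet (tendstoInDistribution_sampleMoment c h ht hindep hI hY hIt
      hXt hmoment hn hnt hτ hτt hnτ hntτ) hβm
  refine ⟨hconsistent, hnormal, fun hpos W' hW' => posSemidef_sandwich_sub hrank hpos hW',
    fun hpos hW0Ω β₀ hβ₀m hβ₀ => ?_⟩
  subst hW0Ω
  exact tendstoInDistribution_invSqrt_sandwich_inv hpos hCm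
    (fun k => aemeasurable_momentVarHat (h.aemeasurable_obs_fst c _) (h.aemeasurable_obs_snd c _)
      (ht.aemeasurable_obs_fst c _) (ht.aemeasurable_obs_snd c _) (hβ₀m k)) hC
    (tendsto_momentVarHat c h ht hI hY hIt hXt hn hnt hτ hτt hnτ hntτ hβ₀)
    (fun k ω => posSemidef_momentVarHat _ _ _ _ _ _ _) hdet hnormal

theorem mainTheorem9 {m d : ℕ}
    -- population
    {S : Type*} [MeasurableSpace S] (μ : Measure S) [IsProbabilityMeasure μ]
    (I It : S → Fin m → ℝ) (X Xt : S → Fin d → ℝ) (Y ε : S → ℝ)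
    (β : EuclideanSpace ℝ (Fin d))
    (hI : Measurable I)
    (hY : ∀ᵐ s ∂μ, Y s = X s ⬝ᵥ β.ofLp + ε s)
    -- finite fourth moments
    (hI4 : ∀ a, MemLp (fun s => I s a) 4 μ) (hX4 : ∀ b, MemLp (fun s => X s b) 4 μ)
    (hY4 : MemLp Y 4 μ)
    (hIt4 : ∀ a, MemLp (fun s => It s a) 4 μ) (hXt4 : ∀ b, MemLp (fun s => Xt s b) 4 μ)
    -- all variables are centered
    (hI0 : ∀ a, ∫ s, I s a ∂μ = 0) (hX0 : ∀ b, ∫ s, X s b ∂μ = 0) (hY0 : ∫ s, Y s ∂μ = 0)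
    (hIt0 : ∀ a, ∫ s, It s a ∂μ = 0) (hXt0 : ∀ b, ∫ s, Xt s b ∂μ = 0)
    -- equal cross-covariances, exogeneity, full rank
    (hcov : UnpairedIV.crossCov μ It Xt = UnpairedIV.crossCov μ I X)
    (hexo : μ[ε | MeasurableSpace.comap I inferInstance] =ᵐ[μ] 0)
    (hrank : (UnpairedIV.crossCov μ I X).rank = d)
    -- two independent i.i.d. samples, of sizes `n k` and `nt k`
    {P₀ : Type*} [MeasurableSpace P₀] (P : Measure P₀) [IsProbabilityMeasure P]
    (Is : ℕ → P₀ → Fin m → ℝ) (Ys : ℕ → P₀ → ℝ)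
    (Its : ℕ → P₀ → Fin m → ℝ) (Xts : ℕ → P₀ → Fin d → ℝ)
    (hid : ∀ i, IdentDistrib (fun ω => (Is i ω, Ys i ω)) (fun s => (I s, Y s)) P μ)
    (hidt : ∀ j, IdentDistrib (fun ω => (Its j ω, Xts j ω)) (fun s => (It s, Xt s)) P μ)
    (hindep : iIndepFun (fun i ω => (Is i ω, Ys i ω)) P)
    (hindept : iIndepFun (fun j ω => (Its j ω, Xts j ω)) P)
    (hindep2 : IndepFun (fun ω i => (Is i ω, Ys i ω)) (fun ω j => (Its j ω, Xts j ω)) P)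
    (n nt : ℕ → ℕ) (hn : Tendsto n atTop atTop) (hnt : Tendsto nt atTop atTop)
    (τ τt : ℝ) (hτ : τ ∈ Set.Ioo (0 : ℝ) 1) (hτt : τt ∈ Set.Ioo (0 : ℝ) 1)
    (hnτ : Tendsto (fun k => (n k : ℝ) / ((n k : ℝ) + nt k)) atTop (𝓝 τ))
    (hntτ : Tendsto (fun k => (nt k : ℝ) / ((n k : ℝ) + nt k)) atTop (𝓝 τt))
    -- weight matrices, converging in probability to a positive definite matrix
    (W : ℕ → P₀ → Matrix (Fin m) (Fin m) ℝ) (W0 : Matrix (Fin m) (Fin m) ℝ)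
    (hWm : ∀ k a b, AEMeasurable (fun ω => W k ω a b) P)
    (hWpos : Tendsto (fun k => P {ω | (W k ω).PosDef}) atTop (𝓝 1))
    (hW0 : W0.PosDef)
    (hW : ∀ a b, TendstoInMeasure P (fun k ω => W k ω a b) atTop (fun _ => W0 a b))
    -- the estimator, from the data as they are or from data centered by their sample means
    (c : UnpairedIV.Centering)
    (βhat : ℕ → P₀ → EuclideanSpace ℝ (Fin d))
    (hβm : ∀ k, AEMeasurable (βhat k) P)
    (hβ : ∀ k, ∀ᵐ ω ∂P, (W k ω).PosDef →
      UnpairedIV.IsGMM (W k ω) (n k) (nt k)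
        (c.obs (n k) fun i => Is i ω) (c.obs (n k) fun i => Ys i ω)
        (c.obs (nt k) fun j => Its j ω) (c.obs (nt k) fun j => Xts j ω) (βhat k ω)) :
    let Ω := UnpairedIV.momentVar μ τ τt I Y It Xt β
    let V := fun W' => UnpairedIV.sandwich (UnpairedIV.crossCov μ It Xt) Ω W'
    -- consistency
    TendstoInMeasure P βhat atTop (fun _ => β) ∧
    -- asymptotic normality
    TendstoInDistribution (fun k ω => √((n k : ℝ) + nt k) • (βhat k ω - β)) atTop id
      (fun _ => P) (multivariateGaussian 0 (V W0)) ∧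
    -- `W0 = Ω⁻¹` minimizes the asymptotic variance in the Loewner order
    (Ω.PosDef → ∀ W' : Matrix (Fin m) (Fin m) ℝ, W'.PosDef → (V W' - V Ω⁻¹).PosSemidef) ∧
    -- for `W0 = Ω⁻¹`, the studentized estimator is asymptotically standard normal
    (Ω.PosDef → W0 = Ω⁻¹ →
      ∀ β₀ : ℕ → P₀ → EuclideanSpace ℝ (Fin d), (∀ k, AEMeasurable (β₀ k) P) →
        TendstoInMeasure P β₀ atTop (fun _ => β) →
        TendstoInDistribution
          (fun k ω => √((n k : ℝ) + nt k) •
            Matrix.toEuclideanCLM (𝕜 := ℝ) (UnpairedIV.invSqrt (UnpairedIV.asymVarHat (n k) (nt k)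
              (c.obs (n k) fun i => Is i ω) (c.obs (n k) fun i => Ys i ω)
              (c.obs (nt k) fun j => Its j ω) (c.obs (nt k) fun j => Xts j ω) (β₀ k ω)))
              (βhat k ω - β))
          atTop id (fun _ => P) (multivariateGaussian 0 1)) := by
  have hI₂ (a : Fin m) : UnpairedIV.CenteredLp 2 μ fun s => I s a :=
    ⟨(hI4 a).mono_exponent (by norm_num), hI0 a⟩
  have hmoment := UnpairedIV.integral_mul_eq_crossCov_mulVec hI hI₂
    (fun b => (hX4 b).mono_exponent (by norm_num)) (hY4.mono_exponent (by norm_num)) hY hexo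
  exact mainTheorem9_general μ I It Xt Y β (fun a => ⟨hI4 a, hI0 a⟩) ⟨hY4, hY0⟩
    (fun a => ⟨hIt4 a, hIt0 a⟩) (fun b => ⟨hXt4 b, hXt0 b⟩) (hcov ▸ hmoment) (hcov ▸ hrank) P Is Ys
    Its Xts ⟨hid, hindep⟩ ⟨hidt, hindept⟩ hindep2 n nt hn hnt τ τt hτ.1 hτt.1 hnτ hntτ W W0 hWm
    hWpos hW0 hW c βhat hβm hβ
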